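/- **Setting.** Let $(\Omega,\mathcal F,\mathbb P,\theta)$ be a probability preserving transformation, $\mathbb T=\mathbb R/\mathbb Z$ with its distance $d_{\mathbb T}$, $L\ge 1$, $N=L+1$, $\alpha>0$. Let $\varphi_1,\dots,\varphi_N:\mathbb N\times\Omega\times\mathbb T\to\mathbb T$ be measurable cocycles over $\theta$ (that is, $\varphi_i(0,\omega,x)=x$ and $\varphi_i(t+s,\omega,\cdot)=\varphi_i(t,\theta^s\omega,\cdot)\circ\varphi_i(s,\omega,\cdot)$), and let $h:\Omega\times\mathbb T^2\to\mathbb R$ be such that: * (R1) the random maps $\varphi_i(1,\theta^t\omega,\cdot)$, $1\le i\le N$, $t\in\mathbb N$, are continuous, independent (in $i$ and $t$) and identically distributed; * (R2) $m$ is the unique stationary probability measure of each $\varphi_i$, that is, the unique $m$ with $\int\mathbb P\{\varphi_i(1,\omega,x)\in B\}\,dm(x)=m(B)$ for all Borel $B$; * (R3) the random functions $h(\theta^t\omega,\cdot,\cdot)$, $t\in\mathbb N$, are measurable in $\omega$, belong to $C^4(\mathbb T^2;\mathbb R)$, and are independent and identically distributed. The star network trajectory $x^t=\Phi_\alpha(t,\omega,x)\in\mathbb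 T^N$, $x^0=x$, with hub $z^t=x_1^t$, is $$z^{t+1}=\varphi_1(1,\theta^t\omega,z^t)+\frac{\alpha}{L}\sum_{j=2}^N h(\theta^t\omega,z^t,x_j^t),\qquad x_j^{t+1}=\varphi_j(1,\theta^t\omega,x_j^t)+\frac{\alpha}{L}h(\theta^t\omega,x_j^t,z^t)\pmod 1,\quad j=2,\dots,N.$$ The fluctuation around the mean-field hub map $\varphi_{\alpha,m}(1,\omega,z)=\varphi_1(1,\omega,z)+\alpha\int h(\omega,z,y)\,dm(y)$ is $$\xi_m(\omega,x)=\alpha\Big[\frac1L\sum_{j=2}^N h(\omega,x_1,x_j)-\int_{\mathbb T}h(\omega,x_1,y)\,dm(y)\Big],\qquad \xi^t(\omega,x)=\xi_m(\theta^t\omega,\Phi_\alpha(t,\omega,x)).$$ The hub admits $\varepsilon$-reduction to $\varphi_{\alpha,m}$ on $(\omega,x)$ with exceptional asymptotic frequency at most $\rho$ if $\limsup_{T\to\infty}\frac1T\#\{0\le t<T:|\xi^t(\omega,x)|>\varepsilon\}\le\rho$. Let the shadowing precision $\varepsilon_s:[0,\infty)\to[0,\infty)$ be nondecreasing with $\varepsilon_s(\delta)\to0$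 as $\delta\to0^+$. Assume absolutely continuous shadowing: there is a map $(\omega,x)\mapsto(\omega_s,x_s)$ of $\Omega\times\mathbb T^N$ preserving $\mathbb P\otimes m^{\otimes N}$ such that for $\mathbb P\otimes m^{\otimes N}$-a.e. $(\omega,x)$ $$\sup_{t}\max_{2\le j\le N}d_{\mathbb T}\big(x_j^t,\varphi_j(t,\omega_s,x_{s,j})\big)\le\varepsilon_s\Big(\alpha L^{-1}\sup_t\|h(\theta^t\omega,\cdot,\cdot)\|_{C^0}\Big)$$ and the empirical measures $\frac1T\sum_{t<T}\delta_{(\varphi_2(t,\omega_s,x_{s,2}),\dots,\varphi_N(t,\omega_s,x_{s,N}))}$ converge weak-$*$ to $m^{\otimes L}$. Assume finally $\sup_{\omega}\|h(\omega,\cdot,\cdot)\|_{C^4}\le K$ with $K>0$, where $\|u\|_{C^4}=\max_{a+b\le4}\|\partial_1^a\partial_2^b u\|_\infty$. **Theorem.** There is an absolute constant $C>0$ such that in every such setting the following hold. (i) For every $\varepsilon\ge\max\{\alpha L^{-1/2},\,4\alpha K\varepsilon_s(\alpha L^{-1}K)\}$ and for $\mathbb P\otimes m^{\otimes N}$-a.e.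 $(\omega,x)$, the hub admits $\varepsilon$-reduction to $\varphi_{\alpha,m}$ with exceptional asymptotic frequency at most $$\rho=C\,\frac{\alpha K}{\varepsilon}\exp\Big(-\frac{450}{K^2}\,\frac{L\varepsilon^2}{\alpha^2}\Big).$$ (ii) Let $\kappa\in(0,1/2)$, $K\ge1$, and suppose that $4\alpha K\varepsilon_s(\alpha L^{-1}K)\le L^{-\kappa}\alpha K^2$. Put $T=\lceil\exp(L^{1-2\kappa})\rceil$. For every $t_0\in\mathbb N$ there is a measurable set $E\subseteq\Omega\times\mathbb T^N$ with $\mathbb P\otimes m^{\otimes N}(E)\le C L^{\kappa}\exp(-L^{1-2\kappa})$ such that $$\max_{t_0\le t\le t_0+T-1}|\xi^t(\omega,x)|\le L^{-\kappa}\alpha K^2\qquad\text{for all }(\omega,x)\notin E.$$ (iii) Suppose $h(\omega,x,y)=\phi(x)-\phi(y)+\psi(\omega)$ with $\phi:\mathbb T\to\mathbb R$ Lipschitz with constant $\ell$ and $\psi$ bounded. Let $\sigma^2=\int\phi^2dm-(\int\phi\,dm)^2$, $\tau=\int|\phi-\int\phi\,dm|^3dm$, and let $F_L$ be the cdf of the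 normal distribution with mean $0$ and variance $\alpha^2\sigma^2/L$ (the unit mass at $0$ if $\sigma=0$). Then for all $t\in\mathbb N$ and $s\in\mathbb R$ $$\mathbb P\otimes m^{\otimes N}\{(\omega,x):\xi^t(\omega,x)\le s\}\in\big[F_L(s-c_1)-c_2,\;F_L(s+c_1)+c_2\big],$$ $$c_1=\alpha\,\ell\,\varepsilon_s\big(\alpha L^{-1}(2\|\phi\|_{C^0}+\|\psi\|_{L^\infty})\big),\qquad c_2=\frac{C\tau}{\sigma^3}L^{-1/2}\quad(c_2=0\text{ if }\sigma=0).$$ -/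

import Mathlib

open MeasureTheory ProbabilityTheory Filter Topology
open scoped ENNReal NNReal

/-- The data of a star network random dynamical system with one hub (node `0`) and `L`
low-degree nodes (nodes `j.succ`, `j : Fin L`) on the circle `ℝ / ℤ`: the noise shift `θ`,
the isolated node dynamics `φ i t ω x`, the pairwise coupling `h ω x y` (influence of a
neighbour in state `y` on a node in state `x`) and the coupling strength `α`. -/
structure StarSystem (Ω : Type*) (L : ℕ) where
  θ : Ω → Ω
  φ : Fin (L + 1) → ℕ → Ω → UnitAddCircle → UnitAddCircle
  h : Ω → UnitAddCircle → UnitAddCircle → ℝ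
  α : ℝ

/-- `φ` is a measurable random dynamical system (cocycle) over `θ`. -/
structure IsRDS {Ω : Type*} [MeasurableSpace Ω] (θ : Ω → Ω)
    (φ : ℕ → Ω → UnitAddCircle → UnitAddCircle) : Prop where
  measurable : Measurable fun p : ℕ × Ω × UnitAddCircle => φ p.1 p.2.1 p.2.2
  zero : ∀ ω x, φ 0 ω x = x
  cocycle : ∀ t s ω x, φ (t + s) ω x = φ t (θ^[s] ω) (φ s ω x)

/-- `m` is stationary for the Markov chain with transition probability
`P(x, B) = ℙ {ω | φ(1, ω, x) ∈ B}`. -/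
def IsStationaryMeasure {Ω : Type*} [MeasurableSpace Ω] (P : Measure Ω)
    (φ : ℕ → Ω → UnitAddCircle → UnitAddCircle) (m : Measure UnitAddCircle) : Prop :=
  ∀ B : Set UnitAddCircle, MeasurableSet B → ∫⁻ x, P {ω | φ 1 ω x ∈ B} ∂m = m B

/-- The 1-periodic (in each variable) function on the plane that a function on the torus lifts to. -/
def torusLift (u : UnitAddCircle → UnitAddCircle → ℝ) (s t : ℝ) : ℝ :=
  u (s : UnitAddCircle) (t : UnitAddCircle)

/-- `u` is of class `C⁴` on the two-dimensional torus. -/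
def IsC4 (u : UnitAddCircle → UnitAddCircle → ℝ) : Prop :=
  ContDiff ℝ 4 fun p : ℝ × ℝ => torusLift u p.1 p.2

/-- The `C⁴` norm: the largest supremum norm of a partial derivative `∂₁ᵃ ∂₂ᵇ u`, `a + b ≤ 4`. -/
noncomputable def c4Norm (u : UnitAddCircle → UnitAddCircle → ℝ) : ℝ≥0∞ :=
  ⨆ (a : ℕ) (b : ℕ) (_ : a + b ≤ 4) (s : ℝ) (t : ℝ),
    ‖iteratedDeriv a (fun s' => iteratedDeriv b (fun t' => torusLift u s' t') t) s‖ₑ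

/-- A shadowing precision: a nonnegative, nondecreasing function `δ ↦ ε_s(δ)` of the size
`δ ≥ 0` of the pseudo-orbit error, converging to `0` as `δ → 0`. -/
structure IsShadowingPrecision (εs : ℝ → ℝ) : Prop where
  nonneg : ∀ δ, 0 ≤ δ → 0 ≤ εs δ
  mono : MonotoneOn εs (Set.Ici 0)
  tendsto : Tendsto εs (𝓝[>] 0) (𝓝 0)

namespace StarSystem

variable {Ω : Type*} {L : ℕ}

/-- One step of the coupled network: the hub feels all low-degree nodes, each low-degree node
feels the hub only; sums are taken modulo `1`. -/
noncomputable def step (S : StarSystem Ω L) (ω : Ω) (x : Fin (L + 1) → UnitAddCircle) :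
    Fin (L + 1) → UnitAddCircle :=
  Fin.cons
    (S.φ 0 1 ω (x 0) +
      ((S.α * (1 / L * ∑ j : Fin L, S.h ω (x 0) (x j.succ)) : ℝ) : UnitAddCircle))
    (fun j : Fin L => S.φ j.succ 1 ω (x j.succ) +
      ((S.α * (1 / L * S.h ω (x j.succ) (x 0)) : ℝ) : UnitAddCircle))

/-- The network trajectory `x^t = Φ_α(t, ω, x)`. -/
noncomputable def orbit (S : StarSystem Ω L) :
    ℕ → Ω → (Fin (L + 1) → UnitAddCircle) → (Fin (L + 1) → UnitAddCircle)
  | 0, _, x => x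
  | t + 1, ω, x => S.step (S.θ^[t] ω) (S.orbit t ω x)

/-- The mean-field reduced hub map `z ↦ φ_{α,m}(1, ω, z)`. -/
noncomputable def reducedMap (S : StarSystem Ω L) (m : Measure UnitAddCircle) (ω : Ω)
    (z : UnitAddCircle) : UnitAddCircle :=
  S.φ 0 1 ω z + ((S.α * ∫ y, S.h ω z y ∂m : ℝ) : UnitAddCircle)

/-- The mean-field fluctuation `ξ_m(ω, x)`. -/
noncomputable def fluct (S : StarSystem Ω L) (m : Measure UnitAddCircle) (ω : Ω)
    (x : Fin (L + 1) → UnitAddCircle) : ℝ :=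
  S.α * (1 / L * ∑ j : Fin L, S.h ω (x 0) (x j.succ) - ∫ y, S.h ω (x 0) y ∂m)

/-- The fluctuation `ξ_m(θ^t ω, Φ_α(t, ω, x))` at time `t` from the initial datum `(ω, x)`. -/
noncomputable def fluctAt (S : StarSystem Ω L) (m : Measure UnitAddCircle) (t : ℕ)
    (p : Ω × (Fin (L + 1) → UnitAddCircle)) : ℝ :=
  S.fluct m (S.θ^[t] p.1) (S.orbit t p.1 p.2)

/-- The hub follows the reduced map up to the fluctuation. -/
theorem orbit_hub (S : StarSystem Ω L) (m : Measure UnitAddCircle) (t : ℕ) (ω : Ω)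
    (x : Fin (L + 1) → UnitAddCircle) :
    S.orbit (t + 1) ω x 0 =
      S.reducedMap m (S.θ^[t] ω) (S.orbit t ω x 0) +
        ((S.fluctAt m t (ω, x) : ℝ) : UnitAddCircle) := by
  simp only [orbit, step, reducedMap, fluctAt, fluct, Fin.cons_zero]
  rw [add_assoc, ← AddCircle.coe_add]
  congr 2
  ring

/-- `ε`-reduction of the hub to the reduced map on the initial datum `p = (ω, x)` with
exceptional asymptotic frequency at most `ρ`. -/
def AdmitsReduction (S : StarSystem Ω L) (m : Measure UnitAddCircle) (ε ρ : ℝ)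
    (p : Ω × (Fin (L + 1) → UnitAddCircle)) : Prop :=
  limsup (fun T : ℕ =>
    (1 / T : ℝ) * (Nat.card {t : ℕ // t < T ∧ ε < |S.fluctAt m t p|} : ℝ)) atTop ≤ ρ

/-- `sup_t ‖h(θ^t ω, ·, ·)‖_{C⁰}`. -/
noncomputable def supC0 (S : StarSystem Ω L) (ω : Ω) : ℝ :=
  ⨆ q : ℕ × UnitAddCircle × UnitAddCircle, |S.h (S.θ^[q.1] ω) q.2.1 q.2.2|

/-- The isolated orbits of the low-degree nodes started from `q = (ω_s, x_s)` shadow the network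
trajectory started from `p = (ω, x)` with precision
`ε_s(α L⁻¹ sup_t ‖h(θ^t ω, ·, ·)‖_{C⁰})`. -/
def Shadowing (S : StarSystem Ω L) (εs : ℝ → ℝ)
    (p q : Ω × (Fin (L + 1) → UnitAddCircle)) : Prop :=
  ∀ (t : ℕ) (j : Fin L),
    dist (S.orbit t p.1 p.2 j.succ) (S.φ j.succ t q.1 (q.2 j.succ)) ≤
      εs (S.α / L * S.supC0 p.1)

/-- The isolated orbits of the low-degree nodes started from `q = (ω_s, x_s)` are jointly
`m^{⊗L}`-typical: their empirical measures converge weak-* to `m^{⊗L}`. -/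
def Typicality (S : StarSystem Ω L) (m : Measure UnitAddCircle)
    (q : Ω × (Fin (L + 1) → UnitAddCircle)) : Prop :=
  ∀ g : C(Fin L → UnitAddCircle, ℝ),
    Tendsto (fun T : ℕ =>
      (1 / T : ℝ) * ∑ t ∈ Finset.range T, g fun j : Fin L => S.φ j.succ t q.1 (q.2 j.succ))
      atTop (𝓝 (∫ y, g y ∂(Measure.pi fun _ : Fin L => m)))

variable [MeasurableSpace Ω]

/-- The standing assumptions on the network over the probability preserving transformation
`(Ω, P, θ)`. Distributions and independence of random continuous circle maps and of random `C⁴`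
couplings are expressed through the product σ-algebra (the one generated by point evaluations),
which induces the Borel σ-algebra on the separable spaces of such maps. -/
structure IsStandard (S : StarSystem Ω L) (P : Measure Ω) (m : Measure UnitAddCircle) :
    Prop where
  shift : MeasurePreserving S.θ P P
  rds : ∀ i, IsRDS S.θ (S.φ i)
  coupling_pos : 0 < S.α
  node_continuous : ∀ i ω, Continuous (S.φ i 1 ω)
  node_indep : iIndepFun
    (fun (q : Fin (L + 1) × ℕ) (ω : Ω) => (S.φ q.1 1 (S.θ^[q.2] ω) :
      UnitAddCircle → UnitAddCircle)) P
  node_identDistrib : ∀ q q' : Fin (L + 1) × ℕ, IdentDistrib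
    (fun ω : Ω => (S.φ q.1 1 (S.θ^[q.2] ω) : UnitAddCircle → UnitAddCircle))
    (fun ω : Ω => (S.φ q'.1 1 (S.θ^[q'.2] ω) : UnitAddCircle → UnitAddCircle)) P P
  stationary : ∀ i, IsStationaryMeasure P (S.φ i) m
  stationary_unique : ∀ i (m' : Measure UnitAddCircle), IsProbabilityMeasure m' →
    IsStationaryMeasure P (S.φ i) m' → m' = m
  coupling_measurable : ∀ x y, Measurable fun ω => S.h ω x y
  coupling_C4 : ∀ ω, IsC4 (S.h ω)
  coupling_indep : iIndepFun
    (fun (t : ℕ) (ω : Ω) (z : UnitAddCircle × UnitAddCircle) => S.h (S.θ^[t] ω) z.1 z.2) P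
  coupling_identDistrib : ∀ t t' : ℕ, IdentDistrib
    (fun (ω : Ω) (z : UnitAddCircle × UnitAddCircle) => S.h (S.θ^[t] ω) z.1 z.2)
    (fun (ω : Ω) (z : UnitAddCircle × UnitAddCircle) => S.h (S.θ^[t'] ω) z.1 z.2) P P

/-- The distribution `ℙ ⊗ m^{⊗N}`, `N = L + 1`, of the initial data. -/
noncomputable def initialLaw (L : ℕ) (P : Measure Ω) (m : Measure UnitAddCircle) :
    Measure (Ω × (Fin (L + 1) → UnitAddCircle)) :=
  P.prod (Measure.pi fun _ : Fin (L + 1) => m)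

/-- Absolutely continuous shadowing with precision `ε_s`: a map `(ω, x) ↦ (ω_s, x_s)` that leaves
`ℙ ⊗ m^{⊗N}` invariant and almost surely yields shadowing and typical initial data. -/
def AdmitsACS (S : StarSystem Ω L) (P : Measure Ω) (m : Measure UnitAddCircle)
    (εs : ℝ → ℝ) : Prop :=
  ∃ A : Ω × (Fin (L + 1) → UnitAddCircle) → Ω × (Fin (L + 1) → UnitAddCircle),
    MeasurePreserving A (initialLaw L P m) (initialLaw L P m) ∧
    ∀ᵐ p ∂(initialLaw L P m), S.Shadowing εs p (A p) ∧ S.Typicality m (A p)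

end StarSystem

/-- Variance of the observable `f` under `m`. -/
noncomputable def obsVar (m : Measure UnitAddCircle) (f : UnitAddCircle → ℝ) : ℝ :=
  ∫ x, f x ^ 2 ∂m - (∫ x, f x ∂m) ^ 2

/-- Third absolute central moment of the observable `f` under `m`. -/
noncomputable def obsThird (m : Measure UnitAddCircle) (f : UnitAddCircle → ℝ) : ℝ :=
  ∫ x, |f x - ∫ y, f y ∂m| ^ 3 ∂m

/-! The fluctuation compares the empirical mean of `h ω z` over the low-degree nodes, `z` being the
hub state, with its mean under `m`. Shadowing replaces the coupled nodes by isolated orbits at the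
cost of a Lipschitz constant times `εs`. At every fixed time the isolated nodes are independent with
law `m` (`map_nodes`): independence in time lets the past be frozen, independence in the node index
factorises the transition, and stationarity preserves each factor. The shadowing map leaves the
initial law invariant, so the same holds for the shadowing orbits.

The obstruction is that the hub state depends on the nodes being averaged. Hence all test functions
with derivative at most one are treated at once: `discrepancy` is their largest deviation. In one
dimension integration by parts bounds it by the L¹ distance between the empirical and the true
distribution function; Jensen's inequality, and Hoeffding's bound at each threshold, then give the
tail `2 exp (-2 L c²)` with no union bound over test functions (`measureReal_discrepancy_gt_le`).
Room for the constant 450 comes from periodicity: descending one order of differentiation gains a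
factor 4, so a fourth derivative bounded by `K` makes `h ω z` Lipschitz with constant `K / 64`. Part
(i) follows by testing typicality against a continuous cut-off of the discrepancy, part (ii) by
invariance of the law and a union bound over the time window.

In (iii) the hub state and the noise cancel, leaving a centred mean of independent variables up to a
shadowing error that shifts the argument of the distribution function by `c₁`. What remains is
Berry–Esseen, proved without characteristic functions (`berryEsseen_convPow`): smooth by a Gaussian
of standard deviation `Λ`, exchange the summands one at a time for Gaussians by a third order Taylor
expansion, and estimate the third derivative through the bound already known for fewer summands. The
recursive error carries a factor `1 / Λ`, removing the smoothing costs a multiple of `Λ / √n`, and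
choosing `Λ` a large multiple of the third moment closes the induction. -/

/-! ### Taylor expansion, convolution and smoothing of distribution functions. -/

section BerryEsseen

/-- Third order Taylor estimate on the line. -/
theorem abs_taylor_three_le {H H₁ H₂ H₃ : ℝ → ℝ} {M : ℝ}
    (h₁ : ∀ y, HasDerivAt H (H₁ y) y) (h₂ : ∀ y, HasDerivAt H₁ (H₂ y) y)
    (h₃ : ∀ y, HasDerivAt H₂ (H₃ y) y) (hM : ∀ y, |H₃ y| ≤ M) (y x : ℝ) :
    |H (y + x) - H y - x * H₁ y - x ^ 2 / 2 * H₂ y| ≤ M * |x| ^ 3 := by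
  -- The mean value inequality on a ball, applied three times, each time gaining one factor `r`. The
  -- sharp constant 1/6 is not needed.
  have key : ∀ (f f' : ℝ → ℝ) (B : ℝ), (∀ z, HasDerivAt f (f' z) z) → f 0 = 0 →
      ∀ r, 0 ≤ r → (∀ z, |z| ≤ r → |f' z| ≤ B) → ∀ z, |z| ≤ r → |f z| ≤ B * r := by
    intro f f' B hf hf0 r hr hB z hz
    have hB0 : 0 ≤ B := (abs_nonneg _).trans (hB 0 (by simpa using hr))
    have := Convex.norm_image_sub_le_of_norm_hasDerivWithin_le (s := Set.Icc (-r) r)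
      (f := f) (f' := f') (C := B) (fun w _ => (hf w).hasDerivWithinAt)
      (fun w hw => hB w (abs_le.2 hw)) (convex_Icc _ _) (x := 0) (y := z)
      (by simpa using hr) (abs_le.1 hz)
    simp only [hf0, sub_zero, Real.norm_eq_abs] at this
    exact this.trans (by gcongr)
  have e2 : ∀ r, 0 ≤ r → ∀ z, |z| ≤ r → |H₂ (y + z) - H₂ y| ≤ M * r := fun r hr =>
    key (fun z => H₂ (y + z) - H₂ y) (fun z => H₃ (y + z)) M
      (fun z => by simpa using ((h₃ (y + z)).comp_const_add y z).sub_const (H₂ y)) (by simp) r hr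
      (fun z _ => hM _)
  have e1 : ∀ r, 0 ≤ r → ∀ z, |z| ≤ r → |H₁ (y + z) - H₁ y - z * H₂ y| ≤ M * r * r :=
    fun r hr => key (fun z => H₁ (y + z) - H₁ y - z * H₂ y) (fun z => H₂ (y + z) - H₂ y) (M * r)
      (fun z => by
        refine ((((h₂ (y + z)).comp_const_add y z).sub_const (H₁ y)).sub
          ((hasDerivAt_id z).mul_const (H₂ y))).congr_deriv ?_
        simp) (by simp) r hr (e2 r hr)
  have e0 := key (fun z => H (y + z) - H y - z * H₁ y - z ^ 2 / 2 * H₂ y)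
      (fun z => H₁ (y + z) - H₁ y - z * H₂ y) (M * |x| * |x|)
      (fun z => by
        have := ((((h₁ (y + z)).comp_const_add y z).sub_const (H y)).sub
          ((hasDerivAt_id z).mul_const (H₁ y))).sub
          ((((hasDerivAt_id z).pow 2).div_const 2).mul_const (H₂ y))
        refine this.congr_deriv ?_
        simp) (by simp) |x| (abs_nonneg _) (e1 |x| (abs_nonneg _)) x le_rfl
  calc _ ≤ M * |x| * |x| * |x| := e0
    _ = _ := by ring

/-- Distribution function of a convolution. -/
theorem cdf_conv (ν ρ : Measure ℝ) [IsProbabilityMeasure ν] [IsProbabilityMeasure ρ] (y : ℝ) :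
    cdf (ν ∗ ρ) y = ∫ x, cdf ν (y - x) ∂ρ := by
  rw [Measure.conv_comm, cdf_eq_real, measureReal_def]
  have h : (ρ ∗ ν) (Set.Iic y) = ∫⁻ x, ENNReal.ofReal (cdf ν (y - x)) ∂ρ := by
    rw [← lintegral_indicator_one measurableSet_Iic,
      Measure.lintegral_conv (measurable_one.indicator measurableSet_Iic)]
    refine lintegral_congr fun x => ?_
    rw [ofReal_cdf, ← lintegral_indicator_one measurableSet_Iic]
    refine lintegral_congr fun z => ?_
    by_cases hz : x + z ≤ y
    · rw [Set.indicator_of_mem (by simpa using hz),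
        Set.indicator_of_mem (by simp only [Set.mem_Iic]; linarith)]
      rfl
    · rw [Set.indicator_of_notMem (by simpa using hz),
        Set.indicator_of_notMem (by simp only [Set.mem_Iic]; linarith)]
  rw [h, integral_eq_lintegral_of_nonneg_ae]
  · exact ae_of_all _ fun x => cdf_nonneg _ _
  · exact ((monotone_cdf ν).measurable.comp (measurable_const.sub measurable_id)).aestronglyMeasurable

theorem integrable_comp_const_sub_of_bounded {q : ℝ → ℝ} (hq : Measurable q) {B : ℝ}
    (hB : ∀ x, |q x| ≤ B) (ν : Measure ℝ) [IsFiniteMeasure ν] (y : ℝ) :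
    Integrable (fun x => q (y - x)) ν :=
  (integrable_const B).mono' (hq.comp (measurable_const.sub measurable_id)).aestronglyMeasurable
    (ae_of_all _ fun _ => hB _)

theorem measurable_cdf_coe (ν : Measure ℝ) : Measurable fun x => cdf ν x :=
  (monotone_cdf ν).measurable

theorem abs_cdf_le_one (ν : Measure ℝ) (x : ℝ) : |cdf ν x| ≤ 1 :=
  abs_le.2 ⟨by linarith [cdf_nonneg ν x], cdf_le_one ν x⟩

/-- Differentiation of `y ↦ ∫ q (y - x) dν` for bounded `q` with bounded derivative. -/
theorem hasDerivAt_integral_comp_sub {q q' : ℝ → ℝ} (hq : ∀ x, HasDerivAt q (q' x) x)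
    (hq' : Continuous q') {B B' : ℝ} (hB : ∀ x, |q x| ≤ B) (hB' : ∀ x, |q' x| ≤ B')
    (ν : Measure ℝ) [IsFiniteMeasure ν] (y : ℝ) :
    HasDerivAt (fun y => ∫ x, q (y - x) ∂ν) (∫ x, q' (y - x) ∂ν) y := by
  have hc : Continuous q := continuous_iff_continuousAt.2 fun x => (hq x).continuousAt
  exact (hasDerivAt_integral_of_dominated_loc_of_deriv_le (F := fun y x => q (y - x))
    (F' := fun y x => q' (y - x)) (bound := fun _ => B') (s := Set.univ) univ_mem
    (Eventually.of_forall fun y => (hc.comp (by fun_prop)).aestronglyMeasurable)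
    (integrable_comp_const_sub_of_bounded hc.measurable hB ν y)
    (hq'.comp (by fun_prop)).aestronglyMeasurable
    (ae_of_all _ fun x y _ => hB' _) (integrable_const _)
    (ae_of_all _ fun x y _ => by
      simpa using (hq (y - x)).comp_sub_const y x)).2

/-- The integral of a function of bounded variation changes by at most its total variation times
the uniform distance of the distribution functions. -/
theorem abs_integral_sub_le_of_cdf_close {q q' : ℝ → ℝ} (hq : ∀ x, HasDerivAt q (q' x) x)
    (hq' : Integrable q') (hbot : Tendsto q atBot (𝓝 0))
    (ν ρ : Measure ℝ) [IsProbabilityMeasure ν] [IsProbabilityMeasure ρ] {D : ℝ}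
    (hD : ∀ x, |cdf ν x - cdf ρ x| ≤ D) (y : ℝ) :
    |∫ x, q (y - x) ∂ν - ∫ x, q (y - x) ∂ρ| ≤ D * ∫ x, |q' x| := by
  -- Integration by parts: write `q a` as the integral of `q'` over `(-∞, a]` and exchange the
  -- integrals by Fubini, so that only the distribution function of `κ` remains.
  have rep : ∀ (κ : Measure ℝ) [IsProbabilityMeasure κ],
      ∫ x, q (y - x) ∂κ = ∫ r, q' r * cdf κ (y - r) := by
    intro κ _
    have h1 : ∀ a, q a = ∫ r, (Set.Iic a).indicator q' r := fun a => by
      rw [integral_indicator measurableSet_Iic,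
        integral_Iic_of_hasDerivAt_of_tendsto' (fun x _ => hq x) hq'.integrableOn hbot, sub_zero]
    have hS : MeasurableSet {p : ℝ × ℝ | p.2 ≤ y - p.1} :=
      measurableSet_le measurable_snd (measurable_const.sub measurable_fst)
    have hint : Integrable (fun p : ℝ × ℝ => {p : ℝ × ℝ | p.2 ≤ y - p.1}.indicator
        (fun p => q' p.2) p) (κ.prod volume) := (hq'.comp_snd κ).indicator hS
    calc ∫ x, q (y - x) ∂κ = ∫ x, (∫ r, {p : ℝ × ℝ | p.2 ≤ y - p.1}.indicator
            (fun p => q' p.2) (x, r)) ∂κ := by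
          refine integral_congr_ae (ae_of_all _ fun x => ?_)
          simp only [h1 (y - x)]
          rfl
      _ = ∫ r, ∫ x, {p : ℝ × ℝ | p.2 ≤ y - p.1}.indicator (fun p => q' p.2) (x, r) ∂κ :=
          integral_integral_swap (f := fun x r => {p : ℝ × ℝ | p.2 ≤ y - p.1}.indicator
            (fun p => q' p.2) (x, r)) hint
      _ = ∫ r, q' r * cdf κ (y - r) := by
          refine integral_congr_ae (ae_of_all _ fun r => ?_)
          have : (fun x => {p : ℝ × ℝ | p.2 ≤ y - p.1}.indicator (fun p => q' p.2) (x, r)) =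
              (Set.Iic (y - r)).indicator fun _ => q' r := by
            ext x
            simp only [Set.indicator_apply, Set.mem_ofPred_eq, Set.mem_Iic]
            congr 1
            exact propext ⟨fun h => by linarith, fun h => by linarith⟩
          simp only [this]
          rw [integral_indicator_const _ measurableSet_Iic, cdf_eq_real, smul_eq_mul, mul_comm]
  have hI : ∀ (κ : Measure ℝ), Integrable fun r => q' r * cdf κ (y - r) := fun κ =>
    hq'.mul_bdd (c := 1)
      ((measurable_cdf_coe κ).comp (measurable_const.sub measurable_id)).aestronglyMeasurable
      (ae_of_all _ fun x => abs_cdf_le_one κ _)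
  rw [rep ν, rep ρ, ← integral_sub (hI ν) (hI ρ), ← integral_const_mul]
  rw [← Real.norm_eq_abs (integral _ _)]
  refine norm_integral_le_of_norm_le (hq'.abs.const_mul D) (ae_of_all _ fun r => ?_)
  simp only [← mul_sub, norm_mul, Real.norm_eq_abs]
  rw [mul_comm]
  exact mul_le_mul_of_nonneg_right (hD _) (abs_nonneg _)

/-- Smoothing: closeness of the distribution functions after convolution with a centred Gaussian
of standard deviation `Λ` implies closeness of the distribution functions. -/
theorem cdf_close_of_conv_close (ν ρ κ : Measure ℝ) [IsProbabilityMeasure ν]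
    [IsProbabilityMeasure ρ] [IsProbabilityMeasure κ] {Λ l η : ℝ} (hΛ : 0 < Λ) (hl : 0 ≤ l)
    (hκi : Integrable (fun z => z ^ 2) κ) (hκ : ∫ z, z ^ 2 ∂κ ≤ Λ ^ 2)
    (hρ : ∀ x y, x ≤ y → cdf ρ y - cdf ρ x ≤ l * (y - x))
    (hη : ∀ s, |cdf (ν ∗ κ) s - cdf (ρ ∗ κ) s| ≤ η) (s : ℝ) :
    |cdf ν s - cdf ρ s| ≤ 2 * η + 8 * l * Λ := by
  set Δ : ℝ → ℝ := fun s => cdf ν s - cdf ρ s with hΔ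
  have hbdd : BddAbove (Set.range fun s => |Δ s|) := by
    refine ⟨2, ?_⟩
    rintro _ ⟨x, rfl⟩
    have := abs_sub (cdf ν x) (cdf ρ x)
    linarith [abs_cdf_le_one ν x, abs_cdf_le_one ρ x]
  set D := ⨆ s, |Δ s| with hD
  have hle : ∀ s, |Δ s| ≤ D := fun s => le_ciSup hbdd s
  have hD0 : 0 ≤ D := (abs_nonneg _).trans (hle 0)
  have hΔm : Measurable Δ := (measurable_cdf_coe ν).sub (measurable_cdf_coe ρ)
  have hconv : ∀ s', ∫ z, Δ (s' - z) ∂κ = cdf (ν ∗ κ) s' - cdf (ρ ∗ κ) s' := fun s' => by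
    rw [cdf_conv, cdf_conv, ← integral_sub]
    · exact integrable_comp_const_sub_of_bounded (measurable_cdf_coe ν) (abs_cdf_le_one ν) κ s'
    · exact integrable_comp_const_sub_of_bounded (measurable_cdf_coe ρ) (abs_cdf_le_one ρ) κ s'
  have hΔi : ∀ s', Integrable (fun z => Δ (s' - z)) κ := fun s' =>
    integrable_comp_const_sub_of_bounded hΔm hle κ s'
  have mono : ∀ a b, a ≤ b → Δ a - l * (b - a) ≤ Δ b := fun a b hab => by
    have := monotone_cdf ν hab
    have := hρ a b hab
    simp only [hΔ]; linarith
  have far : ∀ z, ¬ |z| ≤ 2 * Λ → 1 ≤ z ^ 2 / (4 * Λ ^ 2) := fun z hz => by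
    rw [le_div_iff₀ (by positivity)]
    push Not at hz
    rw [← sq_abs z]; nlinarith
  have half : D * (2 / (4 * Λ ^ 2)) * Λ ^ 2 = D / 2 := by field_simp; ring
  have fint : ∀ c : ℝ, ∫ z, (c + D * (2 / (4 * Λ ^ 2)) * z ^ 2) ∂κ ≤ c + D / 2 := fun c => by
    rw [integral_add (integrable_const _) (hκi.const_mul _), integral_const_mul]
    simp only [integral_const, probReal_univ, one_smul]
    have : D * (2 / (4 * Λ ^ 2)) * ∫ z, z ^ 2 ∂κ ≤ D * (2 / (4 * Λ ^ 2)) * Λ ^ 2 := by gcongr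
    linarith
  -- Shifting by `2Λ` places `s + 2Λ - z` in `[s, s + 4Λ]` when `|z| ≤ 2Λ`, where `Δ` can have
  -- dropped by at most `4lΛ`. The complementary `z` have mass at most 1/4 by Chebyshev and cost at
  -- most `2D` each, hence `D / 2`.
  have upper : ∀ s, Δ s ≤ η + 4 * l * Λ + D / 2 := fun s => by
    have h := integral_mono (μ := κ) (hΔi (s + 2 * Λ)).neg
      ((integrable_const (4 * l * Λ - Δ s)).add (hκi.const_mul (D * (2 / (4 * Λ ^ 2)))))
      (fun z => by
        simp only [Pi.neg_apply, Pi.add_apply]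
        by_cases hz : |z| ≤ 2 * Λ
        · have hz' := abs_le.1 hz
          have := mono s (s + 2 * Λ - z) (by linarith)
          have h1 : l * (s + 2 * Λ - z - s) ≤ l * (4 * Λ) := by gcongr; linarith
          have : 0 ≤ D * (2 / (4 * Λ ^ 2)) * z ^ 2 := by positivity
          linarith
        · have h1 := far z hz
          have h2 : D * (2 / (4 * Λ ^ 2)) * z ^ 2 = 2 * D * (z ^ 2 / (4 * Λ ^ 2)) := by ring
          have h3 : 2 * D * 1 ≤ 2 * D * (z ^ 2 / (4 * Λ ^ 2)) := by gcongr
          have := abs_le.1 (hle s)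
          have := abs_le.1 (hle (s + 2 * Λ - z))
          have : 0 ≤ l * Λ := by positivity
          linarith)
    have h' := h.trans (fint _)
    simp only [Pi.neg_apply] at h'
    rw [integral_neg, hconv] at h'
    have := abs_le.1 (hη (s + 2 * Λ))
    linarith
  have lower : ∀ s, -Δ s ≤ η + 4 * l * Λ + D / 2 := fun s => by
    have h := integral_mono (μ := κ) (hΔi (s - 2 * Λ))
      ((integrable_const (4 * l * Λ + Δ s)).add (hκi.const_mul (D * (2 / (4 * Λ ^ 2)))))
      (fun z => by
        simp only [Pi.add_apply]
        by_cases hz : |z| ≤ 2 * Λ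
        · have hz' := abs_le.1 hz
          have := mono (s - 2 * Λ - z) s (by linarith)
          have h1 : l * (s - (s - 2 * Λ - z)) ≤ l * (4 * Λ) := by gcongr; linarith
          have : 0 ≤ D * (2 / (4 * Λ ^ 2)) * z ^ 2 := by positivity
          linarith
        · have h1 := far z hz
          have h2 : D * (2 / (4 * Λ ^ 2)) * z ^ 2 = 2 * D * (z ^ 2 / (4 * Λ ^ 2)) := by ring
          have h3 : 2 * D * 1 ≤ 2 * D * (z ^ 2 / (4 * Λ ^ 2)) := by gcongr
          have := abs_le.1 (hle s)
          have := abs_le.1 (hle (s - 2 * Λ - z))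
          have : 0 ≤ l * Λ := by positivity
          linarith)
    have h' := h.trans (fint _)
    rw [hconv] at h'
    have := abs_le.1 (hη (s - 2 * Λ))
    linarith
  -- The coefficient 1/2 in front of `D` allows the supremum to be absorbed on the left, which
  -- doubles the other terms.
  have hDle : D ≤ η + 4 * l * Λ + D / 2 := ciSup_le fun s => by
    rw [abs_le]; constructor <;> linarith [upper s, lower s]
  linarith [hle s]

/-! ### Derivatives of the Gaussian density and their bounds. -/

/-- First derivative of the centred Gaussian density of variance `v`. -/
noncomputable def gaussianPDFDeriv (v : ℝ≥0) (x : ℝ) : ℝ := -(x / v) * gaussianPDFReal 0 v x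

/-- Second derivative of the centred Gaussian density of variance `v`. -/
noncomputable def gaussianPDFDeriv₂ (v : ℝ≥0) (x : ℝ) : ℝ :=
  (x ^ 2 / v ^ 2 - 1 / v) * gaussianPDFReal 0 v x

/-- Third derivative of the centred Gaussian density of variance `v`. -/
noncomputable def gaussianPDFDeriv₃ (v : ℝ≥0) (x : ℝ) : ℝ :=
  (3 * x / v ^ 2 - x ^ 3 / v ^ 3) * gaussianPDFReal 0 v x

theorem hasDerivAt_gaussianPDFReal {v : ℝ≥0} (x : ℝ) :
    HasDerivAt (gaussianPDFReal 0 v) (gaussianPDFDeriv v x) x := by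
  have h : HasDerivAt (fun y : ℝ => -(y - 0) ^ 2 / (2 * (v : ℝ))) (-(x / v)) x := by
    refine ((((hasDerivAt_id x).sub_const 0).pow 2).neg.div_const (2 * (v : ℝ))).congr_deriv ?_
    simp only [id_eq, sub_zero, Nat.cast_ofNat]
    by_cases hv : (v : ℝ) = 0
    · simp [hv]
    · field_simp; ring
  refine (h.exp.const_mul (√(2 * Real.pi * v))⁻¹).congr_deriv ?_
  simp only [gaussianPDFDeriv, gaussianPDFReal]
  ring

theorem continuous_gaussianPDFReal (v : ℝ≥0) : Continuous (gaussianPDFReal 0 v) :=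
  continuous_iff_continuousAt.2 fun x => (hasDerivAt_gaussianPDFReal x).continuousAt

theorem hasDerivAt_gaussianPDFDeriv {v : ℝ≥0} (x : ℝ) :
    HasDerivAt (gaussianPDFDeriv v) (gaussianPDFDeriv₂ v x) x := by
  refine (((hasDerivAt_id x).div_const (v : ℝ)).neg.mul
    (hasDerivAt_gaussianPDFReal x)).congr_deriv ?_
  simp only [gaussianPDFDeriv, gaussianPDFDeriv₂, id_eq, Pi.neg_apply]
  ring

theorem hasDerivAt_gaussianPDFDeriv₂ {v : ℝ≥0} (hv : v ≠ 0) (x : ℝ) :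
    HasDerivAt (gaussianPDFDeriv₂ v) (gaussianPDFDeriv₃ v x) x := by
  refine ((((hasDerivAt_id x).pow 2).div_const ((v : ℝ) ^ 2)).sub_const (1 / (v : ℝ)) |>.mul
    (hasDerivAt_gaussianPDFReal x)).congr_deriv ?_
  have : (v : ℝ) ≠ 0 := by exact_mod_cast hv
  simp only [gaussianPDFDeriv, gaussianPDFDeriv₃, id_eq, Nat.cast_ofNat, Pi.pow_apply]
  field_simp
  ring

theorem continuous_gaussianPDFDeriv (v : ℝ≥0) : Continuous (gaussianPDFDeriv v) := by
  unfold gaussianPDFDeriv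
  exact (by fun_prop : Continuous fun x : ℝ => -(x / (v : ℝ))).mul (continuous_gaussianPDFReal v)

theorem continuous_gaussianPDFDeriv₂ (v : ℝ≥0) : Continuous (gaussianPDFDeriv₂ v) := by
  unfold gaussianPDFDeriv₂
  exact (by fun_prop : Continuous fun x : ℝ => x ^ 2 / (v : ℝ) ^ 2 - 1 / (v : ℝ)).mul
    (continuous_gaussianPDFReal v)

theorem continuous_gaussianPDFDeriv₃ (v : ℝ≥0) : Continuous (gaussianPDFDeriv₃ v) := by
  unfold gaussianPDFDeriv₃
  exact (by fun_prop : Continuous fun x : ℝ => 3 * x / (v : ℝ) ^ 2 - x ^ 3 / (v : ℝ) ^ 3).mul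
    (continuous_gaussianPDFReal v)

theorem hasDerivAt_cdf_gaussianReal {v : ℝ≥0} (hv : v ≠ 0) (y : ℝ) :
    HasDerivAt (fun y => cdf (gaussianReal 0 v) y) (gaussianPDFReal 0 v y) y := by
  have hI : ∀ y, cdf (gaussianReal 0 v) y = ∫ x in Set.Iic y, gaussianPDFReal 0 v x := fun y => by
    rw [cdf_eq_real, measureReal_def, gaussianReal_apply_eq_integral _ hv, ENNReal.toReal_ofReal]
    exact integral_nonneg fun x => gaussianPDFReal_nonneg _ _ _
  have hint := integrable_gaussianPDFReal 0 v
  have h : (fun y => cdf (gaussianReal 0 v) y) = fun y =>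
      (∫ x in (0 : ℝ)..y, gaussianPDFReal 0 v x) + ∫ x in Set.Iic 0, gaussianPDFReal 0 v x := by
    ext y
    rw [hI, ← intervalIntegral.integral_Iic_sub_Iic hint.integrableOn hint.integrableOn]
    ring
  rw [h]
  exact ((continuous_gaussianPDFReal v).integral_hasStrictDerivAt 0 y).hasDerivAt.add_const _

theorem gaussianPDFReal_le_exp {v : ℝ≥0} (hv : v ≠ 0) (x : ℝ) :
    gaussianPDFReal 0 v x ≤ (√(v : ℝ))⁻¹ * Real.exp (-((x / √(v : ℝ)) ^ 2 / 2)) := by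
  have hv' : 0 < (v : ℝ) := by exact_mod_cast pos_iff_ne_zero.2 hv
  rw [gaussianPDFReal]
  have h1 : -(x - 0) ^ 2 / (2 * (v : ℝ)) = -((x / √(v : ℝ)) ^ 2 / 2) := by
    rw [div_pow, Real.sq_sqrt hv'.le, sub_zero]; field_simp
  rw [h1]
  gcongr
  nlinarith [Real.pi_gt_three]

theorem gaussianPDFReal_le {v : ℝ≥0} (hv : v ≠ 0) (x : ℝ) :
    |gaussianPDFReal 0 v x| ≤ (√(v : ℝ))⁻¹ := by
  rw [abs_of_nonneg (gaussianPDFReal_nonneg _ _ _)]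
  refine (gaussianPDFReal_le_exp hv x).trans (mul_le_of_le_one_right (by positivity) ?_)
  rw [Real.exp_le_one_iff]
  have := sq_nonneg (x / √(v : ℝ))
  linarith

/-- Half of the Gaussian exponent pays for the polynomial factor: with `y = x / √v`, the bracket is
the second Taylor polynomial of `exp (y² / 4)`, and `exp (-y² / 4)` survives. -/
theorem abs_mul_gaussianPDFReal_le {v : ℝ≥0} (hv : v ≠ 0) {a b x : ℝ} (hb : 0 ≤ b)
    (h : |a| ≤ b * (1 + (x / √(v : ℝ)) ^ 2 / 4 + (x / √(v : ℝ)) ^ 4 / 32)) :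
    |a * gaussianPDFReal 0 v x| ≤ b / √(v : ℝ) * Real.exp (-(1 / (4 * (v : ℝ))) * x ^ 2) := by
  have hv' : 0 < (v : ℝ) := by exact_mod_cast pos_iff_ne_zero.2 hv
  set y := x / √(v : ℝ) with hy
  have hy2 : y ^ 2 = x ^ 2 / v := by rw [hy, div_pow, Real.sq_sqrt hv'.le]
  have hexp : 1 + y ^ 2 / 4 + y ^ 4 / 32 ≤ Real.exp (y ^ 2 / 4) := by
    have := Real.quadratic_le_exp_of_nonneg (x := y ^ 2 / 4) (by positivity)
    linarith [show (y ^ 2 / 4) ^ 2 / 2 = y ^ 4 / 32 by ring]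
  rw [abs_mul, abs_of_nonneg (gaussianPDFReal_nonneg _ _ _)]
  calc |a| * gaussianPDFReal 0 v x
      ≤ (b * Real.exp (y ^ 2 / 4)) * ((√(v : ℝ))⁻¹ * Real.exp (-(y ^ 2 / 2))) := by
        gcongr
        · exact gaussianPDFReal_nonneg _ _ _
        · exact h.trans (by gcongr)
        · exact gaussianPDFReal_le_exp hv x
    _ = b / √(v : ℝ) * (Real.exp (y ^ 2 / 4) * Real.exp (-(y ^ 2 / 2))) := by
        rw [div_eq_mul_inv]; ring
    _ = _ := by
        rw [← Real.exp_add]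
        congr 2
        rw [hy2]; field_simp; ring

theorem abs_gaussianPDFDeriv_le {v : ℝ≥0} (hv : v ≠ 0) (x : ℝ) :
    |gaussianPDFDeriv v x| ≤
      (2 / √(v : ℝ)) / √(v : ℝ) * Real.exp (-(1 / (4 * (v : ℝ))) * x ^ 2) := by
  have hv' : 0 < (v : ℝ) := by exact_mod_cast pos_iff_ne_zero.2 hv
  have hs := Real.sqrt_pos.2 hv'
  refine abs_mul_gaussianPDFReal_le hv (by positivity) ?_
  set y := x / √(v : ℝ) with hy
  have e : x / v = y / √(v : ℝ) := by
    rw [hy, div_div, Real.mul_self_sqrt hv'.le]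
  rw [abs_neg, e, abs_div, abs_of_pos hs, div_mul_eq_mul_div]
  gcongr
  rw [← sq_abs y, ← Even.pow_abs (by decide : Even 4)]
  nlinarith [abs_nonneg y, sq_nonneg (|y| - 1), sq_nonneg (|y| ^ 2)]

theorem abs_gaussianPDFDeriv₂_le {v : ℝ≥0} (hv : v ≠ 0) (x : ℝ) :
    |gaussianPDFDeriv₂ v x| ≤
      (4 / (v : ℝ)) / √(v : ℝ) * Real.exp (-(1 / (4 * (v : ℝ))) * x ^ 2) := by
  have hv' : 0 < (v : ℝ) := by exact_mod_cast pos_iff_ne_zero.2 hv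
  refine abs_mul_gaussianPDFReal_le hv (by positivity) ?_
  set y := x / √(v : ℝ) with hy
  have hy2 : y ^ 2 = x ^ 2 / v := by rw [hy, div_pow, Real.sq_sqrt hv'.le]
  have e : x ^ 2 / (v : ℝ) ^ 2 - 1 / v = (y ^ 2 - 1) / v := by rw [hy2]; field_simp
  rw [e, abs_div, abs_of_pos hv', div_mul_eq_mul_div]
  gcongr
  rw [abs_le]
  constructor <;> nlinarith [sq_nonneg y, sq_nonneg (y ^ 2)]

theorem abs_gaussianPDFDeriv₃_le {v : ℝ≥0} (hv : v ≠ 0) (x : ℝ) :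
    |gaussianPDFDeriv₃ v x| ≤
      (16 / ((v : ℝ) * √(v : ℝ))) / √(v : ℝ) * Real.exp (-(1 / (4 * (v : ℝ))) * x ^ 2) := by
  have hv' : 0 < (v : ℝ) := by exact_mod_cast pos_iff_ne_zero.2 hv
  have hs := Real.sqrt_pos.2 hv'
  refine abs_mul_gaussianPDFReal_le hv (by positivity) ?_
  set y := x / √(v : ℝ) with hy
  have hx : x = y * √(v : ℝ) := by rw [hy]; field_simp
  have hv2 : (v : ℝ) = √(v : ℝ) ^ 2 := (Real.sq_sqrt hv'.le).symm
  have e : 3 * x / (v : ℝ) ^ 2 - x ^ 3 / (v : ℝ) ^ 3 = (3 * y - y ^ 3) / (v * √(v : ℝ)) := by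
    rw [hx]
    generalize √(v : ℝ) = r at *
    rw [hv2]; field_simp
  rw [e, abs_div, abs_of_pos (mul_pos hv' hs), div_mul_eq_mul_div]
  gcongr
  rw [abs_le]
  constructor <;> nlinarith [sq_nonneg y, sq_nonneg (y ^ 2 - y), sq_nonneg (y ^ 2 + y),
    sq_nonneg (y - 1), sq_nonneg (y + 1)]

theorem integrable_exp_neg_sq {v : ℝ≥0} (hv : v ≠ 0) :
    Integrable fun x : ℝ => Real.exp (-(1 / (4 * (v : ℝ))) * x ^ 2) := by
  have hv' : 0 < (v : ℝ) := by exact_mod_cast pos_iff_ne_zero.2 hv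
  exact integrable_exp_neg_mul_sq (by positivity)

theorem integrable_gaussianPDFDeriv₂ {v : ℝ≥0} (hv : v ≠ 0) : Integrable (gaussianPDFDeriv₂ v) :=
  ((integrable_exp_neg_sq hv).const_mul _).mono' (continuous_gaussianPDFDeriv₂ v).aestronglyMeasurable
    (ae_of_all _ fun x => abs_gaussianPDFDeriv₂_le hv x)

theorem integrable_gaussianPDFDeriv₃ {v : ℝ≥0} (hv : v ≠ 0) : Integrable (gaussianPDFDeriv₃ v) :=
  ((integrable_exp_neg_sq hv).const_mul _).mono' (continuous_gaussianPDFDeriv₃ v).aestronglyMeasurable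
    (ae_of_all _ fun x => abs_gaussianPDFDeriv₃_le hv x)

theorem integral_abs_gaussianPDFDeriv₃_le {v : ℝ≥0} (hv : v ≠ 0) :
    ∫ x, |gaussianPDFDeriv₃ v x| ≤ 64 / ((v : ℝ) * √(v : ℝ)) := by
  have hv' : 0 < (v : ℝ) := by exact_mod_cast pos_iff_ne_zero.2 hv
  have hs := Real.sqrt_pos.2 hv'
  refine (integral_mono (integrable_gaussianPDFDeriv₃ hv).abs
    ((integrable_exp_neg_sq hv).const_mul _) (abs_gaussianPDFDeriv₃_le hv)).trans ?_
  rw [integral_const_mul, integral_gaussian]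
  have h : √(Real.pi / (1 / (4 * (v : ℝ)))) ≤ 4 * √(v : ℝ) := by
    refine Real.sqrt_le_iff.2 ⟨by positivity, ?_⟩
    rw [mul_pow, Real.sq_sqrt hv'.le, div_div_eq_mul_div, div_one]
    nlinarith [Real.pi_le_four]
  calc _ ≤ 16 / ((v : ℝ) * √(v : ℝ)) / √(v : ℝ) * (4 * √(v : ℝ)) := by gcongr
    _ = _ := by field_simp; norm_num

theorem exp_neg_mul_sq_le_one (v : ℝ≥0) (x : ℝ) :
    Real.exp (-(1 / (4 * (v : ℝ))) * x ^ 2) ≤ 1 := by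
  rw [Real.exp_le_one_iff]
  have : 0 ≤ 1 / (4 * (v : ℝ)) * x ^ 2 := by positivity
  linarith

/-- The distribution function of `ν ∗ N(0, v)` is three times differentiable, with third derivative
controlled by the distance of `ν` to `N(0, w)`. -/
theorem exists_derivs_cdf_conv_gaussianReal (ν : Measure ℝ) [IsProbabilityMeasure ν] {v w : ℝ≥0}
    (hv : v ≠ 0) {D : ℝ} (hD : ∀ x, |cdf ν x - cdf (gaussianReal 0 w) x| ≤ D) :
    ∃ H₁ H₂ H₃ : ℝ → ℝ,
      (∀ y, HasDerivAt (fun y => cdf (ν ∗ gaussianReal 0 v) y) (H₁ y) y) ∧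
      (∀ y, HasDerivAt H₁ (H₂ y) y) ∧ (∀ y, HasDerivAt H₂ (H₃ y) y) ∧
      ∀ y, |H₃ y| ≤ 4 / (((v + w : ℝ≥0) : ℝ) * √((v + w : ℝ≥0) : ℝ)) +
        D * (64 / ((v : ℝ) * √(v : ℝ))) := by
  have hvw : v + w ≠ 0 := fun h => hv (by simpa using (add_eq_zero.1 h).1)
  set γ := gaussianReal 0 w
  -- Up to third order the derivatives keep the shape of the decomposition: distribution function of
  -- `N(0, v + w)` plus the integral of that of `N(0, v)` against `ν - γ`. The first part is
  -- explicit, the second small when `ν` is close to `γ`.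
  have chain : ∀ {r r' q q' : ℝ → ℝ} {B B' : ℝ}, (∀ x, HasDerivAt r (r' x) x) →
      (∀ x, HasDerivAt q (q' x) x) → Continuous q' → (∀ x, |q x| ≤ B) → (∀ x, |q' x| ≤ B') →
      ∀ y, HasDerivAt (fun y => r y + (∫ x, q (y - x) ∂ν - ∫ x, q (y - x) ∂γ))
        (r' y + (∫ x, q' (y - x) ∂ν - ∫ x, q' (y - x) ∂γ)) y :=
    fun hr hq hq' hB hB' y => (hr y).add ((hasDerivAt_integral_comp_sub hq hq' hB hB' ν y).sub
      (hasDerivAt_integral_comp_sub hq hq' hB hB' γ y))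
  have hv' : 0 < (v : ℝ) := by exact_mod_cast pos_iff_ne_zero.2 hv
  have b1 : ∀ x, |gaussianPDFDeriv v x| ≤ (2 / √(v : ℝ)) / √(v : ℝ) := fun x =>
    (abs_gaussianPDFDeriv_le hv x).trans
      (mul_le_of_le_one_right (by positivity) (exp_neg_mul_sq_le_one v x))
  have b2 : ∀ {v : ℝ≥0}, v ≠ 0 → ∀ x, |gaussianPDFDeriv₂ v x| ≤ (4 / (v : ℝ)) / √(v : ℝ) :=
    fun {v} hv x => (abs_gaussianPDFDeriv₂_le hv x).trans
      (mul_le_of_le_one_right (by positivity) (exp_neg_mul_sq_le_one v x))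
  refine ⟨_, _, _, ?_, chain (fun y => hasDerivAt_gaussianPDFReal (v := v + w) y)
    (fun y => hasDerivAt_gaussianPDFReal (v := v) y) (continuous_gaussianPDFDeriv v)
    (gaussianPDFReal_le hv) b1,
    chain (fun y => hasDerivAt_gaussianPDFDeriv (v := v + w) y)
    (fun y => hasDerivAt_gaussianPDFDeriv (v := v) y) (continuous_gaussianPDFDeriv₂ v) b1 (b2 hv),
    fun y => ?_⟩
  · have h0 := chain (hasDerivAt_cdf_gaussianReal hvw) (hasDerivAt_cdf_gaussianReal hv)
      (continuous_gaussianPDFReal v) (abs_cdf_le_one _) (gaussianPDFReal_le hv)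
    have e : ∀ y, cdf (gaussianReal 0 (v + w)) y + (∫ x, cdf (gaussianReal 0 v) (y - x) ∂ν
        - ∫ x, cdf (gaussianReal 0 v) (y - x) ∂γ) = cdf (ν ∗ gaussianReal 0 v) y := fun y => by
      rw [← cdf_conv, ← cdf_conv, gaussianReal_conv_gaussianReal, Measure.conv_comm]
      simp
    simpa only [e] using h0
  · refine (abs_add_le _ _).trans (add_le_add ?_ ?_)
    · simpa only [div_div] using b2 hvw y
    · have ht : Tendsto (gaussianPDFDeriv₂ v) atBot (𝓝 0) :=
        tendsto_zero_of_hasDerivAt_of_integrableOn_Iic (a := 0)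
          (fun x _ => hasDerivAt_gaussianPDFDeriv₂ hv x)
          (integrable_gaussianPDFDeriv₃ hv).integrableOn
          (integrable_gaussianPDFDeriv₂ hv).integrableOn
      refine (abs_integral_sub_le_of_cdf_close (fun x => hasDerivAt_gaussianPDFDeriv₂ hv x)
        (integrable_gaussianPDFDeriv₃ hv) ht ν γ hD y).trans ?_
      have : 0 ≤ D := (abs_nonneg _).trans (hD 0)
      gcongr
      exact integral_abs_gaussianPDFDeriv₃_le hv

/-! ### Standardized laws. -/

/-- A probability measure on the line with mean zero, variance one and finite third moment. -/
structure IsStandardized (μ : Measure ℝ) : Prop where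
  isProb : IsProbabilityMeasure μ
  integrable_cube : Integrable (fun x => |x| ^ 3) μ
  mean : ∫ x, x ∂μ = 0
  variance : ∫ x, x ^ 2 ∂μ = 1

namespace IsStandardized

variable {μ : Measure ℝ}

theorem integrable_of_le (hμ : IsStandardized μ) {f : ℝ → ℝ} (hf : Continuous f)
    (h : ∀ x, |f x| ≤ 1 + |x| ^ 3) : Integrable f μ := by
  have := hμ.isProb
  exact ((integrable_const 1).add hμ.integrable_cube).mono' hf.aestronglyMeasurable
    (ae_of_all _ h)

theorem integrable_id (hμ : IsStandardized μ) : Integrable (fun x => x) μ :=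
  hμ.integrable_of_le continuous_id fun x => by
    have h := abs_nonneg x
    rcases le_total |x| 1 with h1 | h1
    · have : 0 ≤ |x| ^ 3 := by positivity
      linarith
    · have := le_self_pow₀ h1 (by norm_num : 3 ≠ 0)
      linarith

theorem integrable_sq (hμ : IsStandardized μ) : Integrable (fun x => x ^ 2) μ :=
  hμ.integrable_of_le (by fun_prop) fun x => by
    rw [abs_pow]
    rcases le_total |x| 1 with h1 | h1
    · have : |x| ^ 2 ≤ 1 := pow_le_one₀ (abs_nonneg x) h1
      have : 0 ≤ |x| ^ 3 := by positivity
      linarith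
    · have := pow_le_pow_right₀ h1 (by norm_num : 2 ≤ 3)
      linarith

/-- Integrates `3x² - 1 ≤ 2|x|³`, that is, `(2|x| + 1)(|x| - 1)² ≥ 0`. It lets additive constants be
absorbed into multiples of the third moment. -/
theorem one_le_third (hμ : IsStandardized μ) : 1 ≤ ∫ x, |x| ^ 3 ∂μ := by
  have := hμ.isProb
  have h : ∫ x, (3 * x ^ 2 - 1) ∂μ ≤ ∫ x, 2 * |x| ^ 3 ∂μ := by
    refine integral_mono ((hμ.integrable_sq.const_mul 3).sub (integrable_const _))
      (hμ.integrable_cube.const_mul 2) fun x => ?_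
    have h0 := abs_nonneg x
    simp only [← sq_abs x]
    nlinarith [mul_nonneg (by linarith : (0 : ℝ) ≤ 2 * |x| + 1) (sq_nonneg (|x| - 1))]
  rw [integral_sub (hμ.integrable_sq.const_mul 3) (integrable_const _), integral_const_mul,
    integral_const_mul, hμ.variance] at h
  simp at h
  linarith

/-- Expectation of a smooth function of a standardized variable up to third order. -/
theorem abs_integral_taylor_le (hμ : IsStandardized μ) {H H₁ H₂ H₃ : ℝ → ℝ} {M B : ℝ}
    (h₁ : ∀ y, HasDerivAt H (H₁ y) y) (h₂ : ∀ y, HasDerivAt H₁ (H₂ y) y)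
    (h₃ : ∀ y, HasDerivAt H₂ (H₃ y) y) (hM : ∀ y, |H₃ y| ≤ M) (hB : ∀ y, |H y| ≤ B) (s : ℝ) :
    |∫ x, H (s - x) ∂μ - (H s + H₂ s / 2)| ≤ M * ∫ x, |x| ^ 3 ∂μ := by
  have := hμ.isProb
  have hc : Continuous H := continuous_iff_continuousAt.2 fun x => (h₁ x).continuousAt
  have hi : Integrable (fun x => H (s - x)) μ :=
    integrable_comp_const_sub_of_bounded hc.measurable hB μ s
  have hi1 : Integrable (fun x => x * H₁ s) μ := hμ.integrable_id.mul_const _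
  have hi2 : Integrable (fun x => x ^ 2 / 2 * H₂ s) μ := (hμ.integrable_sq.div_const 2).mul_const _
  have e : ∫ x, H (s - x) ∂μ - (H s + H₂ s / 2) =
      ∫ x, (H (s - x) - H s + x * H₁ s - x ^ 2 / 2 * H₂ s) ∂μ := by
    have hi0 : Integrable (fun x => H (s - x) - H s) μ := hi.sub (integrable_const _)
    have hi01 : Integrable (fun x => H (s - x) - H s + x * H₁ s) μ := hi0.add hi1
    rw [integral_sub hi01 hi2, integral_add hi0 hi1, integral_sub hi (integrable_const _),
      integral_mul_const, integral_mul_const, integral_div, hμ.mean, hμ.variance]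
    simp
    ring
  rw [e, ← integral_const_mul, ← Real.norm_eq_abs (integral _ _)]
  refine norm_integral_le_of_norm_le (hμ.integrable_cube.const_mul M) (ae_of_all _ fun x => ?_)
  have := abs_taylor_three_le h₁ h₂ h₃ hM s (-x)
  rw [abs_neg] at this
  refine le_trans (le_of_eq ?_) this
  rw [Real.norm_eq_abs]
  congr 1
  ring_nf

end IsStandardized

theorem isStandardized_gaussianReal : IsStandardized (gaussianReal 0 1) where
  isProb := inferInstance
  integrable_cube := by
    have := (memLp_id_gaussianReal (μ := 0) (v := 1) 3).integrable_norm_pow (by norm_num)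
    simpa using this
  mean := integral_id_gaussianReal
  variance := by
    have h := variance_fun_id_gaussianReal (μ := 0) (v := 1)
    rw [variance_eq_integral (by fun_prop)] at h
    simpa using h

theorem integral_sq_gaussianReal (v : ℝ≥0) : ∫ x, x ^ 2 ∂gaussianReal 0 v = v := by
  have h := variance_fun_id_gaussianReal (μ := 0) (v := v)
  rw [variance_eq_integral (by fun_prop)] at h
  simpa using h

theorem integrable_sq_gaussianReal (v : ℝ≥0) : Integrable (fun x => x ^ 2) (gaussianReal 0 v) := by
  have := (memLp_id_gaussianReal (μ := 0) (v := v) 2).integrable_norm_pow (by norm_num)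
  simpa using this

/-! ### Lindeberg replacement and the induction for Berry–Esseen. -/

/-- The `k`-fold convolution power of a measure. -/
noncomputable def convPow (μ : Measure ℝ) : ℕ → Measure ℝ
  | 0 => Measure.dirac 0
  | k + 1 => convPow μ k ∗ μ

theorem isProbabilityMeasure_convPow (μ : Measure ℝ) [IsProbabilityMeasure μ] (k : ℕ) :
    IsProbabilityMeasure (convPow μ k) := by
  induction k with
  | zero => exact Measure.dirac.isProbabilityMeasure
  | succ k ih => rw [convPow]; infer_instance

/-- One replacement step. -/
theorem abs_cdf_replace_le {μ : Measure ℝ} (hμ : IsStandardized μ) (ν : Measure ℝ)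
    [IsProbabilityMeasure ν] {v w : ℝ≥0} (hv : v ≠ 0) {D : ℝ}
    (hD : ∀ x, |cdf ν x - cdf (gaussianReal 0 w) x| ≤ D) (s : ℝ) :
    |cdf ((ν ∗ μ) ∗ gaussianReal 0 v) s - cdf (ν ∗ gaussianReal 0 (v + 1)) s| ≤
      (4 / (((v + w : ℝ≥0) : ℝ) * √((v + w : ℝ≥0) : ℝ)) + D * (64 / ((v : ℝ) * √(v : ℝ)))) *
        (∫ x, |x| ^ 3 ∂μ + ∫ x, |x| ^ 3 ∂gaussianReal 0 1) := by
  have := hμ.isProb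
  obtain ⟨H₁, H₂, H₃, h₁, h₂, h₃, hM⟩ := exists_derivs_cdf_conv_gaussianReal ν hv hD
  have e1 : (ν ∗ μ) ∗ gaussianReal 0 v = (ν ∗ gaussianReal 0 v) ∗ μ := by
    rw [Measure.conv_assoc, Measure.conv_assoc, Measure.conv_comm μ]
  have e2 : ν ∗ gaussianReal 0 (v + 1) = (ν ∗ gaussianReal 0 v) ∗ gaussianReal 0 1 := by
    rw [Measure.conv_assoc, gaussianReal_conv_gaussianReal, add_zero]
  rw [e1, e2, cdf_conv, cdf_conv (ν ∗ gaussianReal 0 v)]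
  -- Both laws have mean 0 and variance 1, so both expansions have the same main term `H s + H₂ s /
  -- 2` and only the remainders are left.
  have a1 := hμ.abs_integral_taylor_le h₁ h₂ h₃ hM (abs_cdf_le_one _) s
  have a2 := isStandardized_gaussianReal.abs_integral_taylor_le h₁ h₂ h₃ hM (abs_cdf_le_one _) s
  rw [mul_add]
  rw [abs_le] at *
  constructor <;> linarith [a1.1, a1.2, a2.1, a2.2]

/-- Telescoping bound for the tail of `∑ j^(-3/2)`. -/
theorem sum_inv_mul_sqrt_le {a : ℝ} (ha : 1 ≤ a) (n : ℕ) :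
    ∑ j ∈ Finset.range n, 1 / ((a + j) * √(a + j)) ≤ 4 / √a := by
  -- For `x ≥ 1`, `q ≤ (3/2) r`, hence `q - r = 1 / (q + r) ≥ 2 / (5r)` and `4(q - r) / (rq) ≥
  -- (16/15) / r³`.
  have key : ∀ x : ℝ, 1 ≤ x → 1 / (x * √x) ≤ 4 / √x - 4 / √(x + 1) := fun x hx => by
    have hx0 : 0 < x := by linarith
    set r := √x
    set q := √(x + 1)
    have hr : 0 < r := Real.sqrt_pos.2 hx0
    have hq : 0 < q := Real.sqrt_pos.2 (by linarith)
    have hr2 : r ^ 2 = x := Real.sq_sqrt hx0.le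
    have hq2 : q ^ 2 = x + 1 := Real.sq_sqrt (by linarith)
    have hqr : q ≤ 3 / 2 * r := by
      refine abs_le_of_sq_le_sq' ?_ (by positivity) |>.2
      rw [mul_pow, hq2, hr2]; linarith
    have hrq : r ≤ q := Real.sqrt_le_sqrt (by linarith)
    rw [div_sub_div _ _ hr.ne' hq.ne', div_le_div_iff₀ (by positivity) (by positivity)]
    have h1 : (q - r) * (q + r) = 1 := by nlinarith
    have h2 : 2 / 5 ≤ (q - r) * r := by nlinarith
    have h3 : r * q ≤ 4 * ((q - r) * r) * (r * r) := by
      have : r * q ≤ 3 / 2 * (r * r) := by nlinarith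
      nlinarith [mul_pos hr hr]
    rw [← hr2]
    nlinarith
  have : ∀ n : ℕ, ∑ j ∈ Finset.range n, 1 / ((a + j) * √(a + j)) ≤ 4 / √a - 4 / √(a + n) := by
    intro n
    induction n with
    | zero => simp
    | succ n ih =>
      rw [Finset.sum_range_succ]
      have := key (a + n) (by have := Nat.cast_nonneg (α := ℝ) n; linarith)
      push_cast
      rw [← add_assoc]
      linarith
  have h := this n
  have : 0 ≤ 4 / √(a + n) := by positivity
  linarith

/-- One induction step for the normal approximation error. -/
theorem abs_cdf_convPow_sub_le {μ : Measure ℝ} (hμ : IsStandardized μ) {n : ℕ} (hn : 1 ≤ n)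
    {l : ℝ≥0} (hl : l ≠ 0) {D : ℕ → ℝ}
    (hD : ∀ k < n, ∀ x, |cdf (convPow μ k) x - cdf (gaussianReal 0 (k : ℝ≥0)) x| ≤ D k) (s : ℝ) :
    |cdf (convPow μ n) s - cdf (gaussianReal 0 (n : ℝ≥0)) s| ≤
      2 * ((∑ k ∈ Finset.range n, (4 / (((l : ℝ) + (n - 1)) * √((l : ℝ) + (n - 1))) +
        D (n - 1 - k) * (64 / (((l : ℝ) + k) * √((l : ℝ) + k))))) *
        (∫ x, |x| ^ 3 ∂μ + ∫ x, |x| ^ 3 ∂gaussianReal 0 1)) + 8 * (√n)⁻¹ * √l := by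
  have := hμ.isProb
  have hp := isProbabilityMeasure_convPow μ
  have hn0 : (n : ℝ≥0) ≠ 0 := by exact_mod_cast (by omega : n ≠ 0)
  have hl' : 0 < (l : ℝ) := by exact_mod_cast pos_iff_ne_zero.2 hl
  refine cdf_close_of_conv_close (convPow μ n) (gaussianReal 0 (n : ℝ≥0)) (gaussianReal 0 l)
    (Real.sqrt_pos.2 hl') (by positivity) (integrable_sq_gaussianReal l)
    (by rw [integral_sq_gaussianReal, Real.sq_sqrt hl'.le]) ?_ ?_ s
  · intro x y hxy
    have := Convex.norm_image_sub_le_of_norm_hasDerivWithin_le (s := Set.univ)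
      (f := fun y => cdf (gaussianReal 0 (n : ℝ≥0)) y) (C := (√(((n : ℝ≥0) : ℝ)))⁻¹)
      (fun w _ => (hasDerivAt_cdf_gaussianReal hn0 w).hasDerivWithinAt)
      (fun w _ => gaussianPDFReal_le hn0 w) convex_univ (Set.mem_univ x) (Set.mem_univ y)
    rw [Real.norm_eq_abs, Real.norm_eq_abs, abs_of_nonneg (sub_nonneg.2 hxy)] at this
    simpa using (le_abs_self _).trans this
  · intro s
    set b := ∫ x, |x| ^ 3 ∂μ + ∫ x, |x| ^ 3 ∂gaussianReal 0 1
    -- The interpolation: `j` of the `n` factors have been traded for variance. The extra variance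
    -- `l` keeps the smoothing nondegenerate already at `j = 0`.
    let a : ℕ → ℝ := fun j => cdf (convPow μ (n - j) ∗ gaussianReal 0 (l + j)) s
    have ha0 : a 0 = cdf (convPow μ n ∗ gaussianReal 0 l) s := by simp [a]
    have han : a n = cdf (gaussianReal 0 (n : ℝ≥0) ∗ gaussianReal 0 l) s := by
      simp only [a, Nat.sub_self, convPow, Measure.dirac_zero_conv, gaussianReal_conv_gaussianReal,
        add_zero, add_comm]
    rw [← ha0, ← han, ← Finset.sum_range_sub', Finset.sum_mul]
    refine (Finset.abs_sum_le_sum_abs _ _).trans (Finset.sum_le_sum fun j hj => ?_)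
    have hj := Finset.mem_range.1 hj
    have hlj : l + (j : ℝ≥0) ≠ 0 := fun h => hl (add_eq_zero.1 h).1
    have hstep := abs_cdf_replace_le hμ (convPow μ (n - 1 - j)) hlj
      (hD (n - 1 - j) (by omega)) s
    have e1 : n - j = (n - 1 - j) + 1 := by omega
    have e2 : n - (j + 1) = n - 1 - j := by omega
    -- The total Gaussian variance in the explicit part of the error is `l + (n - 1)` at every step,
    -- independently of `j`.
    have e3 : l + (j : ℝ≥0) + ((n - 1 - j : ℕ) : ℝ≥0) = l + ((n - 1 : ℕ) : ℝ≥0) := by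
      rw [add_assoc, ← Nat.cast_add]
      congr 2
      omega
    have e4 : ((l + ((n - 1 : ℕ) : ℝ≥0) : ℝ≥0) : ℝ) = l + ((n : ℝ) - 1) := by
      rw [NNReal.coe_add, NNReal.coe_natCast, Nat.cast_sub hn, Nat.cast_one]
    rw [e3, e4] at hstep
    simp only [a]
    rw [e2, e1]
    simpa [convPow, add_assoc] using hstep

theorem abs_cdf_sub_cdf_le_one (ν ρ : Measure ℝ) (x : ℝ) : |cdf ν x - cdf ρ x| ≤ 1 := by
  rw [abs_le]
  constructor <;> linarith [cdf_nonneg ν x, cdf_le_one ν x, cdf_nonneg ρ x, cdf_le_one ρ x]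

theorem inv_mul_sqrt_le {x y : ℝ} (hx : 0 < x) (hxy : x ≤ y) :
    1 / (y * √y) ≤ 1 / (x * √x) := by
  have := Real.sqrt_pos.2 hx
  have := hx.trans_le hxy
  gcongr

/-- **Berry–Esseen theorem** for sums of independent standardized variables. -/
theorem berryEsseen_convPow : ∃ C : ℝ, 0 < C ∧ ∀ μ : Measure ℝ, IsStandardized μ →
    ∀ n : ℕ, 1 ≤ n → ∀ s, |cdf (convPow μ n) s - cdf (gaussianReal 0 (n : ℝ≥0)) s| ≤
      C * (∫ x, |x| ^ 3 ∂μ) / √n := by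
  set g := ∫ x, |x| ^ 3 ∂gaussianReal 0 1 with hg
  have hg1 : 1 ≤ g := isStandardized_gaussianReal.one_le_third
  set B := 1 + g with hB
  -- The final bound has coefficient `1032 B + 1024 C B / A + 8 A`. With `A = 2048 B` the recursive
  -- term is `C / 2` and the rest is `17416 B`, so `C = 34832 B` closes the induction.
  set A := 2048 * B with hA
  set C := 34832 * B with hC
  refine ⟨C, by positivity, fun μ hμ n => ?_⟩
  set β := ∫ x, |x| ^ 3 ∂μ with hβ
  have hβ1 : 1 ≤ β := hμ.one_le_third
  induction n using Nat.strong_induction_on with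
  | _ n ih =>
  intro hn s
  have hn0 : 0 < (n : ℝ) := by exact_mod_cast hn
  have hn1 : 1 ≤ (n : ℝ) := by exact_mod_cast hn
  set r := √(n : ℝ) with hr
  have hr0 : 0 < r := Real.sqrt_pos.2 hn0
  have hr2 : r ^ 2 = n := Real.sq_sqrt hn0.le
  set Λ := A * β with hΛ
  have hΛ1 : 1 ≤ Λ := by
    have : 1 ≤ A := by linarith
    exact one_le_mul_of_one_le_of_one_le this hβ1
  have hΛ0 : 0 < Λ := by linarith
  let l : ℝ≥0 := ⟨Λ ^ 2, by positivity⟩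
  have hlc : (l : ℝ) = Λ ^ 2 := rfl
  have hl : l ≠ 0 := by
    rw [← NNReal.coe_ne_zero, hlc]; positivity
  have hl1 : 1 ≤ (l : ℝ) := by rw [hlc]; exact one_le_pow₀ hΛ1
  -- For `i ≥ n / 4` the inductive bound applies, with `√i ≥ √n / 2`. For smaller `i` the trivial
  -- bound 1 suffices, since many factors are then already Gaussian.
  let D : ℕ → ℝ := fun i => if 4 * i < n then 1 else 2 * C * β / r
  have hD : ∀ k < n, ∀ x, |cdf (convPow μ k) x - cdf (gaussianReal 0 (k : ℝ≥0)) x| ≤ D k := by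
    intro k hk x
    by_cases h4 : 4 * k < n
    · simp only [D, h4, if_true]
      exact abs_cdf_sub_cdf_le_one _ _ _
    · simp only [D, h4, if_false]
      refine (ih k hk (by omega) x).trans ?_
      have hk4 : (n : ℝ) ≤ 4 * k := by exact_mod_cast not_lt.1 h4
      have hrk : r / 2 ≤ √(k : ℝ) := by
        refine Real.le_sqrt_of_sq_le ?_
        rw [div_pow, hr2]; linarith
      calc C * β / √(k : ℝ) ≤ C * β / (r / 2) := by gcongr
        _ = _ := by field_simp
  have main := abs_cdf_convPow_sub_le hμ hn hl hD s
  rw [← hβ, ← hg] at main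
  have term : ∀ k ∈ Finset.range n, 4 / (((l : ℝ) + (n - 1)) * √((l : ℝ) + (n - 1))) +
      D (n - 1 - k) * (64 / (((l : ℝ) + k) * √((l : ℝ) + k))) ≤
      516 / (n * r) + 128 * C * β / r * (1 / (((l : ℝ) + k) * √((l : ℝ) + k))) := by
    intro k hk
    have hk := Finset.mem_range.1 hk
    have hk0 : (0 : ℝ) ≤ k := Nat.cast_nonneg k
    have h1 : 4 / (((l : ℝ) + (n - 1)) * √((l : ℝ) + (n - 1))) ≤ 4 / (n * r) := by
      have := inv_mul_sqrt_le hn0 (by linarith : (n : ℝ) ≤ l + (n - 1))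
      rw [div_eq_mul_one_div, div_eq_mul_one_div 4 (_ * r)]
      gcongr
    have h0 : 0 ≤ 1 / (((l : ℝ) + k) * √((l : ℝ) + k)) := by positivity
    have h2 : D (n - 1 - k) * (64 / (((l : ℝ) + k) * √((l : ℝ) + k))) ≤
        512 / (n * r) + 128 * C * β / r * (1 / (((l : ℝ) + k) * √((l : ℝ) + k))) := by
      by_cases h4 : 4 * (n - 1 - k) < n
      · simp only [D, h4, if_true]
        -- Integer arithmetic only gives `n ≤ 4(k + 1)`; the missing one comes from `l ≥ 1`.
        have hk4 : (n : ℝ) / 4 ≤ l + k := by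
          have : (n : ℝ) ≤ 4 * (k + 1) := by exact_mod_cast (by omega : n ≤ 4 * (k + 1))
          linarith
        have := inv_mul_sqrt_le (by positivity : (0 : ℝ) < n / 4) hk4
        have e : √((n : ℝ) / 4) = r / 2 := by
          rw [Real.sqrt_div hn0.le, show (4 : ℝ) = 2 ^ 2 by norm_num, Real.sqrt_sq (by norm_num)]
        rw [e] at this
        have e2 : 1 / ((n : ℝ) / 4 * (r / 2)) = 8 * (1 / (n * r)) := by field_simp; norm_num
        rw [e2] at this
        have h5 : 0 ≤ 128 * C * β / r * (1 / (((l : ℝ) + k) * √((l : ℝ) + k))) := by positivity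
        rw [div_eq_mul_one_div 64, div_eq_mul_one_div 512]
        linarith
      · simp only [D, h4, if_false]
        have : 0 ≤ 512 / (n * r) := by positivity
        have e : 2 * C * β / r * (64 / (((l : ℝ) + k) * √((l : ℝ) + k))) =
            128 * C * β / r * (1 / (((l : ℝ) + k) * √((l : ℝ) + k))) := by ring
        rw [e]
        linarith
    have e : 516 / (n * r) = 4 / (n * r) + 512 / (n * r) := by ring
    linarith
  have hsum := Finset.sum_le_sum term
  rw [Finset.sum_add_distrib (g := fun k : ℕ => 128 * C * β / r * (1 / (((l : ℝ) + k) *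
    √((l : ℝ) + k)))), Finset.sum_const, Finset.card_range, nsmul_eq_mul, ← Finset.mul_sum] at hsum
  have htail := sum_inv_mul_sqrt_le hl1 n
  rw [hlc, Real.sqrt_sq hΛ0.le, ← hlc] at htail
  have hsum2 : ∑ k ∈ Finset.range n, (4 / (((l : ℝ) + (n - 1)) * √((l : ℝ) + (n - 1))) +
      D (n - 1 - k) * (64 / (((l : ℝ) + k) * √((l : ℝ) + k)))) ≤ (516 + 512 * C / A) / r := by
    refine hsum.trans ?_
    calc _ ≤ n * (516 / (n * r)) + 128 * C * β / r * (4 / Λ) := by gcongr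
      _ = _ := by rw [hΛ]; field_simp; ring
  have hB0 : 0 < B := by linarith
  have hBβ : β + g ≤ B * β := by nlinarith
  calc _ ≤ 2 * ((516 + 512 * C / A) / r * (B * β)) + 8 * r⁻¹ * Λ := by
        refine main.trans ?_
        rw [show √(l : ℝ) = Λ by rw [hlc, Real.sqrt_sq hΛ0.le]]
        gcongr
    _ = C * β / r := by
        rw [hΛ, hC, hA]
        field_simp
        ring

/-- The law of a sum of independent variables with common law `μ` is a convolution power. -/
theorem map_sum_eq_convPow {Ω ι : Type*} [MeasurableSpace Ω] {P : Measure Ω}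
    [IsProbabilityMeasure P] {X : ι → Ω → ℝ} (hX : ∀ i, Measurable (X i)) (hind : iIndepFun X P)
    {μ : Measure ℝ} (hμ : ∀ i, P.map (X i) = μ) (t : Finset ι) :
    P.map (fun ω => ∑ i ∈ t, X i ω) = convPow μ t.card := by
  classical
  induction t using Finset.induction_on with
  | empty =>
    simp [convPow, Measure.map_const]
  | insert i t hi ih =>
    have h := hind.indepFun_finsetSum_of_notMem hX hi
    have hm : Measurable (∑ j ∈ t, X j) := by fun_prop
    have h2 := h.map_add_eq_map_conv_map₀ hm.aemeasurable (hX i).aemeasurable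
    rw [Finset.card_insert_of_notMem hi, convPow, ← ih, ← hμ i]
    have e1 : (fun ω => ∑ j ∈ insert i t, X j ω) = (∑ j ∈ t, X j) + X i := by
      ext ω; simp [Finset.sum_insert hi, add_comm]
    have e2 : (fun ω => ∑ j ∈ t, X j ω) = ∑ j ∈ t, X j := by ext ω; simp
    rw [e1, e2, h2]

end BerryEsseen

/-! ### Normal approximation for observables on the circle. -/

section Observables

variable {m : Measure UnitAddCircle} [IsProbabilityMeasure m]

theorem integrable_of_continuous_circle {f : UnitAddCircle → ℝ} (hf : Continuous f) :
    Integrable f m :=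
  hf.integrable_of_hasCompactSupport (HasCompactSupport.of_compactSpace f)

theorem obsVar_eq_integral_sq {f : UnitAddCircle → ℝ} (hf : Continuous f) :
    obsVar m f = ∫ x, (f x - ∫ y, f y ∂m) ^ 2 ∂m := by
  set c := ∫ y, f y ∂m with hc
  have h1 : Integrable f m := integrable_of_continuous_circle hf
  have h2 : Integrable (fun x => f x ^ 2) m := integrable_of_continuous_circle (by fun_prop)
  have e : ∀ x, (f x - c) ^ 2 = f x ^ 2 - 2 * c * f x + c ^ 2 := fun x => by ring
  have h3 : Integrable (fun x => f x ^ 2 - 2 * c * f x) m := h2.sub (h1.const_mul _)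
  simp only [e]
  rw [integral_add h3 (integrable_const _), integral_sub h2 (h1.const_mul _), integral_const_mul,
    ← hc, obsVar, ← hc]
  simp
  ring

theorem obsVar_nonneg {f : UnitAddCircle → ℝ} (hf : Continuous f) : 0 ≤ obsVar m f := by
  rw [obsVar_eq_integral_sq hf]
  exact integral_nonneg fun x => sq_nonneg _

theorem ae_eq_integral_of_obsVar_eq_zero {f : UnitAddCircle → ℝ} (hf : Continuous f)
    (h : obsVar m f = 0) : ∀ᵐ x ∂m, f x = ∫ y, f y ∂m := by
  have hi : Integrable (fun x => (f x - ∫ y, f y ∂m) ^ 2) m :=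
    integrable_of_continuous_circle ((hf.sub continuous_const).pow 2)
  rw [obsVar_eq_integral_sq hf, integral_eq_zero_iff_of_nonneg (fun x => sq_nonneg _) hi] at h
  filter_upwards [h] with x hx
  have : f x - ∫ y, f y ∂m = 0 := by simpa using hx
  linarith

/-- Distribution function of a centred Gaussian in terms of another one. -/
theorem cdf_gaussianReal_scale {v : ℝ≥0} {c : ℝ} (hc : 0 < c) (s : ℝ) :
    cdf (gaussianReal 0 (NNReal.mk (c ^ 2) (sq_nonneg c) * v)) s = cdf (gaussianReal 0 v) (s / c) := by
  have h := gaussianReal_map_const_mul (μ := 0) (v := v) c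
  rw [mul_zero] at h
  have := Measure.isProbabilityMeasure_map (μ := gaussianReal 0 v) (f := fun x => c * x) (by fun_prop)
  rw [← h, cdf_eq_real, cdf_eq_real, map_measureReal_apply (by fun_prop) measurableSet_Iic]
  congr 1
  ext x
  simp [le_div_iff₀ hc, mul_comm]

/-- Normal approximation for empirical means of a continuous observable. -/
theorem exists_berryEsseen_const : ∃ C : ℝ, 0 < C ∧
    ∀ (m : Measure UnitAddCircle) [IsProbabilityMeasure m] (f : UnitAddCircle → ℝ),
      Continuous f → ∀ L : ℕ, 1 ≤ L → ∀ α : ℝ, 0 < α → ∀ s : ℝ,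
      |(Measure.pi fun _ : Fin L => m).real
          {y | α * (∫ x, f x ∂m - 1 / L * ∑ j, f (y j)) ≤ s} -
        cdf (gaussianReal 0 (α ^ 2 * obsVar m f / L).toNNReal) s| ≤
      C * (obsThird m f / √(obsVar m f) ^ 3) / √(L : ℝ) := by
  obtain ⟨C, hC, hBE⟩ := berryEsseen_convPow
  refine ⟨C, hC, fun m _ f hf L hL α hα s => ?_⟩
  -- At variance zero the right side is 0 by the convention `x / 0 = 0`, so equality is required. It
  -- holds because `f` is almost surely constant and both laws are the unit mass at 0.
  rcases (obsVar_nonneg (m := m) hf).eq_or_lt with hσ | hσ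
  · have hae : ∀ᵐ y ∂(Measure.pi fun _ : Fin L => m), ∀ j, f (y j) = ∫ x, f x ∂m :=
      ae_all_iff.2 fun j => (measurePreserving_eval (fun _ : Fin L => m) j).quasiMeasurePreserving.ae
        (ae_eq_integral_of_obsVar_eq_zero hf hσ.symm)
    have hL0 : (L : ℝ) ≠ 0 := by exact_mod_cast (by omega : L ≠ 0)
    have hset : {y : Fin L → UnitAddCircle | α * (∫ x, f x ∂m - 1 / L * ∑ j, f (y j)) ≤ s}
        =ᵐ[Measure.pi fun _ : Fin L => m] {_y | 0 ≤ s} := by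
      filter_upwards [hae] with y hy
      have e : α * (∫ x, f x ∂m - 1 / L * ∑ j, f (y j)) = 0 := by
        simp [hy, hL0]
      change (_ ≤ s) = (0 ≤ s)
      rw [e]
    rw [measureReal_congr hset, ← hσ]
    simp only [mul_zero, zero_div, Real.toNNReal_zero, gaussianReal_zero_var, cdf_eq_real,
      Real.sqrt_zero]
    by_cases hs : 0 ≤ s
    · simp [hs, measureReal_def]
    · simp [hs, measureReal_def]
  set σ := √(obsVar m f) with hσd
  have hσ0 : 0 < σ := Real.sqrt_pos.2 hσ
  have hσ2 : σ ^ 2 = obsVar m f := Real.sq_sqrt hσ.le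
  set c := ∫ x, f x ∂m with hc
  have hL0 : 0 < (L : ℝ) := by exact_mod_cast hL
  -- The sign `c - f` matches the fluctuation: `α` times the mean of `c - f` over the points is `ασ
  -- / L` times the sum of the `X (y j)`, whence the threshold `s / (ασ / L)` below.
  let X : UnitAddCircle → ℝ := fun x => (c - f x) / σ
  have hXc : Continuous X := by fun_prop
  set μ := m.map X with hμ
  have hμp : IsProbabilityMeasure μ := Measure.isProbabilityMeasure_map hXc.measurable.aemeasurable
  have hmapI : ∀ g : ℝ → ℝ, Continuous g → ∫ x, g x ∂μ = ∫ x, g (X x) ∂m := fun g hg =>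
    integral_map hXc.measurable.aemeasurable hg.aestronglyMeasurable
  have hstd : IsStandardized μ := by
    refine ⟨hμp, ?_, ?_, ?_⟩
    · rw [hμ, integrable_map_measure (by fun_prop) hXc.measurable.aemeasurable]
      exact integrable_of_continuous_circle (by fun_prop)
    · rw [hmapI (fun x => x) continuous_id]
      simp only [X]
      rw [integral_div, integral_sub (integrable_const _) (integrable_of_continuous_circle hf), ← hc]
      simp
    · rw [hmapI (fun x => x ^ 2) (by fun_prop)]
      simp only [X, div_pow]
      rw [integral_div, hσ2, obsVar_eq_integral_sq hf, ← hc]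
      simp only [fun x => sub_sq_comm c (f x)]
      rw [div_self]
      rw [hc, ← obsVar_eq_integral_sq hf]; exact hσ.ne'
  have hthird : ∫ x, |x| ^ 3 ∂μ = obsThird m f / σ ^ 3 := by
    rw [hmapI (fun x => |x| ^ 3) (by fun_prop), obsThird, ← hc, ← integral_div]
    simp only [X, abs_div, div_pow, abs_of_pos hσ0, abs_sub_comm c]
  have hind : iIndepFun (fun (j : Fin L) (y : Fin L → UnitAddCircle) => X (y j))
      (Measure.pi fun _ : Fin L => m) :=
    iIndepFun_pi (X := fun _ => X) fun _ => hXc.measurable.aemeasurable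
  have hlaw := map_sum_eq_convPow (P := Measure.pi fun _ : Fin L => m)
    (X := fun (j : Fin L) (y : Fin L → UnitAddCircle) => X (y j))
    (fun j => hXc.measurable.comp (measurable_pi_apply j)) hind (μ := μ) (fun j => by
      have h1 : (fun y : Fin L → UnitAddCircle => X (y j)) = X ∘ Function.eval j := rfl
      rw [h1, ← Measure.map_map hXc.measurable (measurable_pi_apply j),
        (measurePreserving_eval (fun _ : Fin L => m) j).map_eq]) Finset.univ
  rw [Finset.card_univ, Fintype.card_fin] at hlaw
  have hSm : Measurable fun y : Fin L → UnitAddCircle => ∑ j, X (y j) :=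
    Finset.measurable_sum _ fun j _ => hXc.measurable.comp (measurable_pi_apply j)
  have hp : IsProbabilityMeasure (Measure.map (fun y : Fin L → UnitAddCircle => ∑ j, X (y j))
      (Measure.pi fun _ : Fin L => m)) := Measure.isProbabilityMeasure_map hSm.aemeasurable
  have hb := hBE μ hstd L hL (s / (α * σ / L))
  rw [← hlaw, hthird, cdf_eq_real, map_measureReal_apply hSm measurableSet_Iic] at hb
  have hk : 0 < α * σ / L := by positivity
  rw [← cdf_gaussianReal_scale hk] at hb
  have e1 : (NNReal.mk ((α * σ / L) ^ 2) (sq_nonneg _) * (L : ℝ≥0) : ℝ≥0) =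
      (α ^ 2 * obsVar m f / L).toNNReal := by
    ext
    rw [Real.coe_toNNReal _ (by positivity), NNReal.coe_mul, NNReal.coe_natCast]
    simp only [NNReal.coe_mk]
    rw [← hσ2]; field_simp
  have e2 : (fun y : Fin L → UnitAddCircle => ∑ j, X (y j)) ⁻¹' Set.Iic (s / (α * σ / L)) =
      {y | α * (c - 1 / L * ∑ j, f (y j)) ≤ s} := by
    ext y
    simp only [Set.mem_preimage, Set.mem_Iic, Set.mem_ofPred_eq, le_div_iff₀ hk]
    have : (∑ j, X (y j)) * (α * σ / L) = α * (c - 1 / L * ∑ j, f (y j)) := by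
      simp only [X, ← Finset.sum_div, Finset.sum_sub_distrib, Finset.sum_const, Finset.card_univ,
        Fintype.card_fin, nsmul_eq_mul]
      field_simp
    rw [this]
  rw [e1, e2] at hb
  exact hb

end Observables

/-! ### Discrepancy of independent points on the circle. -/

section Discrepancy

/-- The representative in `[0, 1)` of a point of the circle. -/
noncomputable def circleRep (x : UnitAddCircle) : ℝ := (AddCircle.equivIco 1 0 x : ℝ)

theorem measurable_circleRep : Measurable circleRep :=
  measurable_subtype_coe.comp (AddCircle.measurableEquivIco 1 0).measurable

theorem circleRep_mem (x : UnitAddCircle) : circleRep x ∈ Set.Ico (0 : ℝ) 1 := by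
  simpa [circleRep] using (AddCircle.equivIco 1 0 x).2

theorem coe_circleRep (x : UnitAddCircle) : (circleRep x : UnitAddCircle) = x :=
  AddCircle.coe_equivIco

/-- Functions on the circle of class `C¹` with derivative bounded by one. -/
def IsUnitC1 (u : UnitAddCircle → ℝ) : Prop :=
  ContDiff ℝ 1 (fun t : ℝ => u t) ∧ ∀ t : ℝ, |deriv (fun t : ℝ => u t) t| ≤ 1

/-- Subtracting the nearest integer from `a - b` gives lifts joined by a segment whose length is the
circle distance; the mean value inequality is applied along it. -/
theorem lipschitzWith_of_abs_deriv_le {u : UnitAddCircle → ℝ} {K : ℝ≥0}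
    (hu : Differentiable ℝ fun t : ℝ => u t) (h : ∀ t : ℝ, |deriv (fun t : ℝ => u t) t| ≤ K) :
    LipschitzWith K u := by
  refine LipschitzWith.of_dist_le_mul fun x y => ?_
  obtain ⟨b, rfl⟩ := QuotientAddGroup.mk_surjective y
  obtain ⟨a, rfl⟩ := QuotientAddGroup.mk_surjective x
  set c : ℝ := (a - b) - round (a - b) with hc
  have h1 : dist (a : UnitAddCircle) (b : UnitAddCircle) = |c| := by
    rw [dist_eq_norm, ← AddCircle.coe_sub, AddCircle.norm_eq]
    simp [hc]
  have h2 : (a : UnitAddCircle) = ((b + c : ℝ) : UnitAddCircle) := by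
    have : a = b + c + (round (a - b) : ℤ) := by rw [hc]; ring
    conv_lhs => rw [this]
    rw [AddCircle.coe_add]
    simp
  have h3 := Convex.norm_image_sub_le_of_norm_deriv_le (f := fun t : ℝ => u t) (s := Set.univ)
    (fun x _ => hu x) (fun x _ => h x) convex_univ (Set.mem_univ b) (Set.mem_univ (b + c))
  have h4 : dist (u (a : UnitAddCircle)) (u (b : UnitAddCircle)) ≤ K * |c| := by
    rw [h2, Real.dist_eq]
    simpa using h3
  rw [← h1] at h4
  exact h4

theorem IsUnitC1.lipschitz {u : UnitAddCircle → ℝ} (hu : IsUnitC1 u) : LipschitzWith 1 u :=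
  lipschitzWith_of_abs_deriv_le (hu.1.differentiable (by norm_num)) (by simpa using hu.2)

theorem isUnitC1_zero : IsUnitC1 fun _ => 0 := ⟨contDiff_const, by simp⟩

variable {L : ℕ} (m : Measure UnitAddCircle)

/-- Deviation of the empirical mean of `u` over the points `y` from the mean under `m`. -/
noncomputable def empDev (u : UnitAddCircle → ℝ) (y : Fin L → UnitAddCircle) : ℝ :=
  1 / L * ∑ j, u (y j) - ∫ x, u x ∂m

/-- The largest deviation over the `C¹` functions with derivative bounded by one. -/
noncomputable def discrepancy (y : Fin L → UnitAddCircle) : ℝ :=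
  ⨆ u : {u : UnitAddCircle → ℝ // IsUnitC1 u}, |empDev m u.1 y|

theorem abs_empDev_sub_le (hL : 1 ≤ L) {u : UnitAddCircle → ℝ} {K : ℝ≥0} (hu : LipschitzWith K u)
    (y y' : Fin L → UnitAddCircle) {d : ℝ} (hd : ∀ j, dist (y j) (y' j) ≤ d) :
    |empDev m u y - empDev m u y'| ≤ K * d := by
  have hL0 : (L : ℝ) ≠ 0 := by exact_mod_cast (by omega : L ≠ 0)
  have e : empDev m u y - empDev m u y' = 1 / L * ∑ j, (u (y j) - u (y' j)) := by
    rw [empDev, empDev, Finset.sum_sub_distrib]; ring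
  rw [e, abs_mul, abs_of_nonneg (by positivity)]
  calc 1 / (L : ℝ) * |∑ j, (u (y j) - u (y' j))| ≤ 1 / (L : ℝ) * ∑ _j : Fin L, K * d := by
        gcongr
        refine (Finset.abs_sum_le_sum_abs _ _).trans (Finset.sum_le_sum fun j _ => ?_)
        have := hu.dist_le_mul (y j) (y' j)
        rw [Real.dist_eq] at this
        exact this.trans (by gcongr; exact hd j)
    _ = K * d := by simp; field_simp

variable [IsProbabilityMeasure m]

theorem abs_empDev_le_of_dist (hL : 1 ≤ L) {u : UnitAddCircle → ℝ} (hu : Continuous u) {D : ℝ}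
    (hD : ∀ x y, |u x - u y| ≤ D) (y : Fin L → UnitAddCircle) : |empDev m u y| ≤ D := by
  have hL0 : (L : ℝ) ≠ 0 := by exact_mod_cast (by omega : L ≠ 0)
  have hi : Integrable u m := integrable_of_continuous_circle hu
  have h : ∀ j, |u (y j) - ∫ x, u x ∂m| ≤ D := fun j => by
    have e : u (y j) - ∫ x, u x ∂m = ∫ x, (u (y j) - u x) ∂m := by
      rw [integral_sub (integrable_const _) hi]; simp
    rw [e, ← Real.norm_eq_abs]
    simpa using norm_integral_le_of_norm_le_const (μ := m) (f := fun x => u (y j) - u x)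
      (ae_of_all _ fun x => hD (y j) x)
  have e : empDev m u y = 1 / L * ∑ j, (u (y j) - ∫ x, u x ∂m) := by
    rw [empDev, Finset.sum_sub_distrib]
    simp
    field_simp
  rw [e, abs_mul, abs_of_nonneg (by positivity)]
  calc 1 / (L : ℝ) * |∑ j, (u (y j) - ∫ x, u x ∂m)| ≤ 1 / (L : ℝ) * ∑ _j : Fin L, D := by
        gcongr
        exact (Finset.abs_sum_le_sum_abs _ _).trans (Finset.sum_le_sum fun j _ => h j)
    _ = D := by simp; field_simp

theorem dist_circle_le_one (x y : UnitAddCircle) : dist x y ≤ 1 := by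
  rw [dist_eq_norm]
  refine (AddCircle.norm_le_half_period 1 one_ne_zero).trans ?_
  norm_num

/-- Supplies the upper bound without which the real supremum in `discrepancy` would default to 0. -/
theorem abs_empDev_le_one (hL : 1 ≤ L) {u : UnitAddCircle → ℝ} (hu : IsUnitC1 u)
    (y : Fin L → UnitAddCircle) : |empDev m u y| ≤ 1 := by
  refine abs_empDev_le_of_dist m hL hu.lipschitz.continuous (fun x y => ?_) y
  have := hu.lipschitz.dist_le_mul x y
  rw [Real.dist_eq] at this
  exact this.trans (by simpa using dist_circle_le_one x y)

theorem abs_empDev_le_discrepancy (hL : 1 ≤ L) {u : UnitAddCircle → ℝ} (hu : IsUnitC1 u)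
    (y : Fin L → UnitAddCircle) : |empDev m u y| ≤ discrepancy m y := by
  refine le_ciSup (f := fun u : {u : UnitAddCircle → ℝ // IsUnitC1 u} => |empDev m u.1 y|)
    ⟨1, ?_⟩ ⟨u, hu⟩
  rintro _ ⟨v, rfl⟩
  exact abs_empDev_le_one m hL v.2 y

/-- A supremum of 1-Lipschitz functions of `y` is 1-Lipschitz. Continuity yields measurability of
this uncountable supremum and makes it usable in test functions for weak convergence. -/
theorem lipschitzWith_discrepancy (hL : 1 ≤ L) :
    LipschitzWith 1 (discrepancy m : (Fin L → UnitAddCircle) → ℝ) := by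
  refine LipschitzWith.of_le_add fun y y' => ?_
  have : Nonempty {u : UnitAddCircle → ℝ // IsUnitC1 u} := ⟨⟨_, isUnitC1_zero⟩⟩
  refine ciSup_le fun u => ?_
  have h1 := abs_empDev_sub_le m hL u.2.lipschitz y y' (fun j => dist_le_pi_dist y y' j)
  have h2 := abs_empDev_le_discrepancy m hL u.2 y'
  have h3 := abs_sub_abs_le_abs_sub (empDev m u.1 y) (empDev m u.1 y')
  simp only [NNReal.coe_one, one_mul] at h1
  linarith

/-- Deviation of the empirical distribution function. -/
noncomputable def empCdfDev (s : ℝ) (y : Fin L → UnitAddCircle) : ℝ :=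
  1 / L * ∑ j, (Set.Ioi s).indicator (fun _ => (1 : ℝ)) (circleRep (y j)) -
    ∫ x, (Set.Ioi s).indicator (fun _ => (1 : ℝ)) (circleRep x) ∂m

theorem measurable_indicator_circleRep :
    Measurable fun p : ℝ × UnitAddCircle =>
      (Set.Ioi p.1).indicator (fun _ => (1 : ℝ)) (circleRep p.2) := by
  have h : MeasurableSet {p : ℝ × UnitAddCircle | p.1 < circleRep p.2} :=
    measurableSet_lt measurable_fst (measurable_circleRep.comp measurable_snd)
  exact (measurable_const (a := (1 : ℝ))).indicator h

theorem measurable_empCdfDev :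
    Measurable fun p : ℝ × (Fin L → UnitAddCircle) => empCdfDev m p.1 p.2 := by
  unfold empCdfDev
  refine Measurable.sub (Measurable.const_mul (Finset.measurable_sum _ fun j _ => ?_) _) ?_
  · exact measurable_indicator_circleRep.comp
      (measurable_fst.prodMk ((measurable_pi_apply j).comp measurable_snd))
  · have := measurable_indicator_circleRep.stronglyMeasurable.integral_prod_right' (ν := m)
    exact this.measurable.comp measurable_fst

theorem abs_indicator_one_le (A : Set ℝ) (x : ℝ) : A.indicator (fun _ => (1 : ℝ)) x ∈ Set.Icc 0 1 := by
  by_cases h : x ∈ A <;> simp [h]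

theorem abs_empCdfDev_le (hL : 1 ≤ L) (s : ℝ) (y : Fin L → UnitAddCircle) :
    |empCdfDev m s y| ≤ 1 := by
  have hL0 : (0 : ℝ) < L := by exact_mod_cast hL
  have h1 : (∑ j, (Set.Ioi s).indicator (fun _ => (1 : ℝ)) (circleRep (y j))) ∈
      Set.Icc (0 : ℝ) L := by
    constructor
    · exact Finset.sum_nonneg fun j _ => (abs_indicator_one_le _ _).1
    · refine (Finset.sum_le_sum fun j _ => (abs_indicator_one_le _ _).2).trans ?_
      simp
  have h2 : ∫ x, (Set.Ioi s).indicator (fun _ => (1 : ℝ)) (circleRep x) ∂m ∈ Set.Icc (0 : ℝ) 1 := by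
    constructor
    · exact integral_nonneg fun x => (abs_indicator_one_le _ _).1
    · refine (integral_mono_of_nonneg (ae_of_all _ fun x => (abs_indicator_one_le _ _).1)
        (integrable_const (1 : ℝ)) (ae_of_all _ fun x => (abs_indicator_one_le _ _).2)).trans ?_
      simp
  have h3 : 1 / (L : ℝ) * ∑ j, (Set.Ioi s).indicator (fun _ => (1 : ℝ)) (circleRep (y j)) ∈
      Set.Icc (0 : ℝ) 1 := by
    constructor
    · exact mul_nonneg (by positivity) h1.1
    · rw [one_div_mul_eq_div, div_le_one hL0]; exact h1.2
  rw [empCdfDev, abs_le]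
  constructor <;> linarith [h2.1, h2.2, h3.1, h3.2]

/-- The deviation of a `C¹` function expressed through the empirical distribution function. -/
theorem empDev_eq_integral (hL : 1 ≤ L) {u : UnitAddCircle → ℝ}
    (hu : ContDiff ℝ 1 fun t : ℝ => u t) (y : Fin L → UnitAddCircle) :
    empDev m u y =
      ∫ s in Set.Ioc (0 : ℝ) 1, deriv (fun t : ℝ => u t) s * empCdfDev m s y := by
  have hL0 : (L : ℝ) ≠ 0 := by exact_mod_cast (by omega : L ≠ 0)
  set u' := deriv (fun t : ℝ => u t) with hu'
  have hc : Continuous u' := hu.continuous_deriv le_rfl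
  have hui : IntegrableOn u' (Set.Ioc 0 1) :=
    (hc.integrableOn_Icc (a := 0) (b := 1)).mono_set Set.Ioc_subset_Icc_self
  let J : ℝ → UnitAddCircle → ℝ := fun s x => (Set.Ioi s).indicator (fun _ => (1 : ℝ)) (circleRep x)
  have hJm : ∀ x, Measurable fun s => J s x := fun x =>
    measurable_indicator_circleRep.comp (measurable_id.prodMk measurable_const)
  have hJb : ∀ s x, ‖J s x‖ ≤ 1 := fun s x => by
    have := abs_indicator_one_le (Set.Ioi s) (circleRep x)
    rw [Real.norm_eq_abs, abs_of_nonneg this.1]; exact this.2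
  have hJi : ∀ x, IntegrableOn (fun s => u' s * J s x) (Set.Ioc 0 1) := fun x =>
    hui.mul_bdd (c := 1) (hJm x).aestronglyMeasurable (ae_of_all _ fun s => hJb s x)
  -- The fundamental theorem of calculus from 0 to the representative of `x`. The boundary value `u
  -- 0` has the same mean under both probability measures and cancels.
  have rep : ∀ x, u x = u 0 + ∫ s in Set.Ioc (0 : ℝ) 1, u' s * J s x := fun x => by
    have hr := circleRep_mem x
    have h1 : ∫ s in (0 : ℝ)..circleRep x, u' s = u x - u 0 := by
      rw [intervalIntegral.integral_deriv_eq_sub (fun t _ => hu.differentiable (by norm_num) t)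
        (hc.intervalIntegrable _ _), coe_circleRep]
      simp
    have h2 : (fun s => u' s * J s x) = (Set.Iio (circleRep x)).indicator u' := by
      ext s
      simp only [J, Set.indicator_apply, Set.mem_Ioi, Set.mem_Iio]
      split_ifs <;> simp
    rw [h2, setIntegral_indicator measurableSet_Iio]
    have h3 : Set.Ioc (0 : ℝ) 1 ∩ Set.Iio (circleRep x) = Set.Ioo 0 (circleRep x) := by
      ext s
      simp only [Set.mem_inter_iff, Set.mem_Ioc, Set.mem_Iio, Set.mem_Ioo]
      constructor
      · rintro ⟨⟨a, b⟩, c⟩; exact ⟨a, c⟩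
      · rintro ⟨a, c⟩; exact ⟨⟨a, (c.trans hr.2).le⟩, c⟩
    rw [h3, ← integral_Ioc_eq_integral_Ioo, ← intervalIntegral.integral_of_le hr.1, h1]
    ring
  have hprod : Integrable (fun p : UnitAddCircle × ℝ => u' p.2 * J p.2 p.1)
      (m.prod (volume.restrict (Set.Ioc 0 1))) := by
    refine (Integrable.comp_snd hui m).mul_bdd (c := 1) ?_ (ae_of_all _ fun p => hJb _ _)
    exact (measurable_indicator_circleRep.comp measurable_swap).aestronglyMeasurable
  have hmean : ∫ x, u x ∂m = u 0 + ∫ s in Set.Ioc (0 : ℝ) 1, u' s * ∫ x, J s x ∂m := by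
    calc ∫ x, u x ∂m = ∫ x, (u 0 + ∫ s in Set.Ioc (0 : ℝ) 1, u' s * J s x) ∂m :=
          integral_congr_ae (ae_of_all _ rep)
      _ = u 0 + ∫ x, (∫ s in Set.Ioc (0 : ℝ) 1, u' s * J s x) ∂m := by
          rw [integral_add (integrable_const _) hprod.integral_prod_left]; simp
      _ = _ := by
          rw [integral_integral_swap (f := fun x s => u' s * J s x) hprod]
          simp only [integral_const_mul]
  have hMi : IntegrableOn (fun s => u' s * ∫ x, J s x ∂m) (Set.Ioc 0 1) := by
    have := hprod.integral_prod_right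
    simp only [integral_const_mul] at this
    exact this
  have hS : ∑ j, u (y j) = L * u 0 + ∫ s in Set.Ioc (0 : ℝ) 1, ∑ j, u' s * J s (y j) := by
    rw [integral_finsetSum _ fun j _ => hJi (y j), Finset.sum_congr rfl fun j _ => rep (y j),
      Finset.sum_add_distrib]
    simp
  have hSi : IntegrableOn (fun s => 1 / (L : ℝ) * ∑ j, u' s * J s (y j)) (Set.Ioc 0 1) :=
    (integrable_finsetSum _ fun j _ => hJi (y j)).const_mul _
  rw [empDev, hmean, hS, mul_add, ← integral_const_mul]
  have e : ∀ s, u' s * empCdfDev m s y =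
      1 / (L : ℝ) * ∑ j, u' s * J s (y j) - u' s * ∫ x, J s x ∂m := fun s => by
    rw [empCdfDev, ← Finset.mul_sum]
    ring
  simp only [e]
  rw [integral_sub hSi hMi]
  field_simp
  ring

/-- Moment generating function of the deviation of the empirical distribution function. -/
theorem integral_exp_abs_empCdfDev_le (hL : 1 ≤ L) (c s : ℝ) :
    ∫ y, Real.exp (c * |empCdfDev m s y|) ∂(Measure.pi fun _ : Fin L => m) ≤
      2 * Real.exp (c ^ 2 / (8 * L)) := by
  have hL0 : (L : ℝ) ≠ 0 := by exact_mod_cast (by omega : L ≠ 0)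
  let π := Measure.pi fun _ : Fin L => m
  let f : UnitAddCircle → ℝ := fun x => (Set.Ioi s).indicator (fun _ => (1 : ℝ)) (circleRep x)
  have hf : Measurable f :=
    measurable_indicator_circleRep.comp (measurable_const.prodMk measurable_id)
  set M := ∫ x, f x ∂m with hM
  have hind : iIndepFun (fun (j : Fin L) (y : Fin L → UnitAddCircle) => f (y j) - M) π :=
    iIndepFun_pi (X := fun _ x => f x - M) fun _ => (hf.sub_const M).aemeasurable
  have hmeanj : ∀ j : Fin L, ∫ y, f (y j) ∂π = M := fun j => by
    have := integral_map (μ := π) (φ := Function.eval j) (f := f)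
      (measurable_pi_apply j).aemeasurable hf.aestronglyMeasurable
    rw [(measurePreserving_eval (fun _ : Fin L => m) j).map_eq] at this
    exact this.symm
  have hsub : ∀ j ∈ (Finset.univ : Finset (Fin L)), HasSubgaussianMGF
      (fun y : Fin L → UnitAddCircle => f (y j) - M) ((‖(1 : ℝ) - 0‖₊ / 2) ^ 2) π := fun j _ => by
    have := hasSubgaussianMGF_of_mem_Icc (μ := π) (X := fun y : Fin L → UnitAddCircle => f (y j))
      (a := 0) (b := 1) (hf.comp (measurable_pi_apply j)).aemeasurable
      (ae_of_all _ fun y => abs_indicator_one_le _ _)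
    rwa [hmeanj] at this
  have hG := HasSubgaussianMGF.sum_of_iIndepFun hind hsub
  have e : ∀ y, empCdfDev m s y = 1 / L * ∑ j, (f (y j) - M) := fun y => by
    rw [empCdfDev, Finset.sum_sub_distrib]
    simp [f, hM]
    field_simp
  have h1 := hG.mgf_le (c / L)
  have h2 := hG.mgf_le (-(c / L))
  have i1 := hG.integrable_exp_mul (c / L)
  have i2 := hG.integrable_exp_mul (-(c / L))
  -- Hoeffding: each of the `L` variables with values in `[0, 1]` has variance proxy 1/4, and `L ·
  -- (1/4) · (c/L)² / 2 = c² / (8L)`.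
  have ev : ((∑ _j : Fin L, ((‖(1 : ℝ) - 0‖₊ / 2) ^ 2 : ℝ≥0) : ℝ≥0) : ℝ) * (c / L) ^ 2 / 2 =
      c ^ 2 / (8 * L) := by
    simp
    field_simp
    ring
  rw [neg_sq, ev] at h2
  rw [ev] at h1
  calc ∫ y, Real.exp (c * |empCdfDev m s y|) ∂π
      ≤ ∫ y, (Real.exp (c / L * ∑ j, (f (y j) - M)) +
          Real.exp (-(c / L) * ∑ j, (f (y j) - M))) ∂π := by
        refine integral_mono_of_nonneg (ae_of_all _ fun y => (Real.exp_pos _).le) (i1.add i2)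
          (ae_of_all _ fun y => ?_)
        simp only [e]
        set z := ∑ j, (f (y j) - M)
        rcases abs_cases (1 / (L : ℝ) * z) with h | h
        · rw [h.1, show c * (1 / (L : ℝ) * z) = c / L * z by ring]
          linarith [Real.exp_pos (-(c / L) * z)]
        · rw [h.1, show c * -(1 / (L : ℝ) * z) = -(c / L) * z by ring]
          linarith [Real.exp_pos (c / L * z)]
    _ ≤ _ := by
        rw [integral_add i1 i2]
        simp only [mgf] at h1 h2
        linarith

/-- Concentration of the discrepancy of independent points. -/
theorem measureReal_discrepancy_gt_le (hL : 1 ≤ L) {c : ℝ} (hc : 0 ≤ c) :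
    (Measure.pi fun _ : Fin L => m).real {y | c < discrepancy m y} ≤
      2 * Real.exp (-(2 * L * c ^ 2)) := by
  have hL0 : (0 : ℝ) < L := by exact_mod_cast hL
  set π := Measure.pi fun _ : Fin L => m with hπ
  -- This `k` minimises the Chernoff exponent `k² / (8L) - kc`, with value `-2Lc²`.
  set k : ℝ := 4 * L * c with hk
  have hk0 : 0 ≤ k := by positivity
  set vol := (volume : Measure ℝ).restrict (Set.Ioc 0 1) with hvol
  have hvp : IsProbabilityMeasure vol := ⟨by simp [hvol]⟩
  have hmeas : Measurable fun p : ℝ × (Fin L → UnitAddCircle) =>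
      Real.exp (k * |empCdfDev m p.1 p.2|) :=
    Real.measurable_exp.comp ((continuous_abs.measurable.comp (measurable_empCdfDev m)).const_mul k)
  have hbd : ∀ (s : ℝ) (y : Fin L → UnitAddCircle),
      ‖Real.exp (k * |empCdfDev m s y|)‖ ≤ Real.exp k := fun s y => by
    rw [Real.norm_eq_abs, abs_of_pos (Real.exp_pos _), Real.exp_le_exp]
    exact mul_le_of_le_one_right hk0 (abs_empCdfDev_le m hL s y)
  have hprod : Integrable (fun p : ℝ × (Fin L → UnitAddCircle) =>
      Real.exp (k * |empCdfDev m p.1 p.2|)) (vol.prod π) :=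
    (integrable_const (Real.exp k)).mono' hmeas.aestronglyMeasurable
      (ae_of_all _ fun p => hbd p.1 p.2)
  let J : (Fin L → UnitAddCircle) → ℝ := fun y => ∫ s, Real.exp (k * |empCdfDev m s y|) ∂vol
  have hJi : Integrable J π := hprod.integral_prod_right
  have hJ0 : ∀ y, 0 ≤ J y := fun y => integral_nonneg fun s => (Real.exp_pos _).le
  have hJint : ∫ y, J y ∂π ≤ 2 * Real.exp (k ^ 2 / (8 * L)) := by
    have h1 : ∫ y, J y ∂π = ∫ s, ∫ y, Real.exp (k * |empCdfDev m s y|) ∂π ∂vol :=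
      (integral_integral_swap (f := fun s y => Real.exp (k * |empCdfDev m s y|)) hprod).symm
    rw [h1]
    refine (integral_mono hprod.integral_prod_left (integrable_const (2 * Real.exp (k ^ 2 / (8 * L))))
      fun s => integral_exp_abs_empCdfDev_le m hL k s).trans ?_
    simp
  have hmy : ∀ y : Fin L → UnitAddCircle, Measurable fun s => empCdfDev m s y := fun y =>
    (measurable_empCdfDev m).comp (measurable_id.prodMk measurable_const)
  have habsi : ∀ y : Fin L → UnitAddCircle, Integrable (fun s => |empCdfDev m s y|) vol := fun y =>
    (integrable_const (1 : ℝ)).mono' (hmy y).abs.aestronglyMeasurable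
      (ae_of_all _ fun s => by simpa using abs_empCdfDev_le m hL s y)
  -- The L¹ norm of the distribution function deviation dominates every test function
  -- simultaneously, and Jensen's inequality moves the exponential inside, so only the bound at a
  -- single threshold is needed.
  have hexp : ∀ y : Fin L → UnitAddCircle, Real.exp (k * discrepancy m y) ≤ J y := fun y => by
    have h1 : discrepancy m y ≤ ∫ s, |empCdfDev m s y| ∂vol := by
      have : Nonempty {u : UnitAddCircle → ℝ // IsUnitC1 u} := ⟨⟨_, isUnitC1_zero⟩⟩
      refine ciSup_le fun u => ?_
      rw [empDev_eq_integral m hL u.2.1, ← Real.norm_eq_abs (integral _ _)]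
      refine norm_integral_le_of_norm_le (habsi y) (ae_of_all _ fun s => ?_)
      rw [norm_mul]
      exact mul_le_of_le_one_left (abs_nonneg _) (u.2.2 s)
    calc Real.exp (k * discrepancy m y) ≤ Real.exp (∫ s, k * |empCdfDev m s y| ∂vol) := by
          rw [integral_const_mul]; gcongr
      _ ≤ J y := by
          refine convexOn_exp.map_integral_le (f := fun s => k * |empCdfDev m s y|)
            Real.continuous_exp.continuousOn isClosed_univ (by simp) ((habsi y).const_mul k) ?_
          exact (integrable_const (Real.exp k)).mono'
            (hmeas.comp (measurable_id.prodMk measurable_const)).aestronglyMeasurable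
            (ae_of_all _ fun s => hbd s y)
  have hsub : {y | c < discrepancy m y} ⊆ {y | Real.exp (k * c) ≤ J y} := fun y hy =>
    (Real.exp_le_exp.2 (mul_le_mul_of_nonneg_left (le_of_lt hy) hk0)).trans (hexp y)
  have hmk := mul_meas_ge_le_integral_of_nonneg (ae_of_all π hJ0) hJi (Real.exp (k * c))
  have h1 : π.real {y | c < discrepancy m y} ≤ π.real {y | Real.exp (k * c) ≤ J y} :=
    measureReal_mono hsub
  have h2 : Real.exp (k * c) * π.real {y | c < discrepancy m y} ≤
      2 * Real.exp (k ^ 2 / (8 * L)) :=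
    (mul_le_mul_of_nonneg_left h1 (Real.exp_pos _).le).trans (hmk.trans hJint)
  have e : 2 * Real.exp (-(2 * L * c ^ 2)) = 2 * Real.exp (k ^ 2 / (8 * L)) / Real.exp (k * c) := by
    rw [mul_div_assoc, ← Real.exp_sub]
    congr 2
    rw [hk]; field_simp; ring
  rw [e, le_div_iff₀ (Real.exp_pos _), mul_comm]
  exact h2

end Discrepancy

/-! ### The law of the isolated nodes at a fixed time. -/

section NodeLaw

/-- Independent variables: the probability of a joint event is obtained by freezing one of them. -/
theorem measure_joint_eq_lintegral_of_indepFun {Ω Ω' E : Type*} [MeasurableSpace Ω]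
    [MeasurableSpace Ω'] [MeasurableSpace E] {P : Measure Ω} [IsProbabilityMeasure P]
    {X : Ω → E} {Z : Ω → Ω'} (hX : Measurable X) (hZ : Measurable Z) (h : IndepFun X Z P)
    {Q : Set (E × Ω')} (hQ : MeasurableSet Q) :
    P {ω | (X ω, Z ω) ∈ Q} = ∫⁻ ω, P {ω' | (X ω, Z ω') ∈ Q} ∂P := by
  have := Measure.isProbabilityMeasure_map (μ := P) hX.aemeasurable
  have := Measure.isProbabilityMeasure_map (μ := P) hZ.aemeasurable
  have h1 := h.map_prod_eq_prod_map_map hX.aemeasurable hZ.aemeasurable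
  calc P {ω | (X ω, Z ω) ∈ Q} = P.map (fun ω => (X ω, Z ω)) Q :=
        (Measure.map_apply (hX.prodMk hZ) hQ).symm
    _ = ∫⁻ x, P.map Z (Prod.mk x ⁻¹' Q) ∂(P.map X) := by rw [h1, Measure.prod_apply hQ]
    _ = ∫⁻ ω, P.map Z (Prod.mk (X ω) ⁻¹' Q) ∂P :=
        lintegral_map (measurable_measure_prodMk_left hQ) hX
    _ = _ := lintegral_congr fun ω => Measure.map_apply hZ (measurable_prodMk_left hQ)

variable {Ω : Type*} {L : ℕ}

/-- The isolated orbits of the low-degree nodes. -/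
def StarSystem.nodes (S : StarSystem Ω L) (t : ℕ) (q : Ω × (Fin (L + 1) → UnitAddCircle)) :
    Fin L → UnitAddCircle := fun j => S.φ j.succ t q.1 (q.2 j.succ)

/-- The information on the node maps at the times in `A`. -/
@[reducible]
def StarSystem.mapInfo (S : StarSystem Ω L) (A : Set ℕ) : MeasurableSpace Ω :=
  ⨆ q ∈ {q : Fin (L + 1) × ℕ | q.2 ∈ A},
    MeasurableSpace.comap (fun ω : Ω => (S.φ q.1 1 (S.θ^[q.2] ω) : UnitAddCircle → UnitAddCircle))
      MeasurableSpace.pi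

theorem StarSystem.mapInfo_mono (S : StarSystem Ω L) {A B : Set ℕ} (h : A ⊆ B) :
    S.mapInfo A ≤ S.mapInfo B :=
  biSup_mono fun _ hq => h hq

theorem StarSystem.measurable_map_mapInfo (S : StarSystem Ω L) {A : Set ℕ} {t : ℕ} (ht : t ∈ A)
    (i : Fin (L + 1)) (x : UnitAddCircle) :
    Measurable[S.mapInfo A] fun ω => S.φ i 1 (S.θ^[t] ω) x := by
  have h1 : Measurable[MeasurableSpace.comap (fun ω : Ω =>
      (S.φ i 1 (S.θ^[t] ω) : UnitAddCircle → UnitAddCircle)) MeasurableSpace.pi]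
      fun ω => S.φ i 1 (S.θ^[t] ω) x :=
    (measurable_pi_apply x).comp (comap_measurable _)
  refine h1.mono ?_ le_rfl
  exact le_biSup (fun q : Fin (L + 1) × ℕ => MeasurableSpace.comap
    (fun ω : Ω => (S.φ q.1 1 (S.θ^[q.2] ω) : UnitAddCircle → UnitAddCircle)) MeasurableSpace.pi)
    (show ((i, t) : Fin (L + 1) × ℕ) ∈ {q : Fin (L + 1) × ℕ | q.2 ∈ A} from ht)

variable [MeasurableSpace Ω] {P : Measure Ω} {m : Measure UnitAddCircle} {S : StarSystem Ω L}

namespace StarSystem.IsStandard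

theorem measurable_node (hS : S.IsStandard P m) (i : Fin (L + 1)) (t : ℕ) :
    Measurable fun p : Ω × UnitAddCircle => S.φ i t p.1 p.2 :=
  (hS.rds i).measurable.comp (measurable_const.prodMk measurable_id)

theorem measurable_nodes (hS : S.IsStandard P m) (t : ℕ) : Measurable (S.nodes t) :=
  measurable_pi_lambda _ fun j => (hS.measurable_node j.succ t).comp
    (measurable_fst.prodMk ((measurable_pi_apply j.succ).comp measurable_snd))

theorem measurable_iterate (hS : S.IsStandard P m) (t : ℕ) : Measurable (S.θ^[t]) :=
  (hS.shift.iterate t).measurable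

theorem mapInfo_le (hS : S.IsStandard P m) (A : Set ℕ) : S.mapInfo A ≤ ‹MeasurableSpace Ω› := by
  refine iSup₂_le fun q _ => Measurable.comap_le (measurable_pi_lambda _ fun x => ?_)
  exact (hS.measurable_node q.1 1).comp ((hS.measurable_iterate q.2).prodMk measurable_const)

/-- Joint measurability of a node map with respect to the information on it. -/
theorem measurable_node_mapInfo (hS : S.IsStandard P m) {A : Set ℕ} {t : ℕ} (ht : t ∈ A)
    (i : Fin (L + 1)) :
    @Measurable (UnitAddCircle × Ω) UnitAddCircle (@Prod.instMeasurableSpace _ _ _ (S.mapInfo A)) _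
      fun p => S.φ i 1 (S.θ^[t] p.2) p.1 :=
  -- Point evaluations alone give measurability in `ω` for each `x`; continuity in `x` upgrades this
  -- to joint measurability.
  @measurable_uncurry_of_continuous_of_measurable Ω UnitAddCircle UnitAddCircle _ _ _ _ _ _ _ _ _
    (S.mapInfo A) (fun x ω => S.φ i 1 (S.θ^[t] ω) x)
    (fun ω => hS.node_continuous i (S.θ^[t] ω)) (fun x => S.measurable_map_mapInfo ht i x)

theorem node_succ (hS : S.IsStandard P m) (i : Fin (L + 1)) (t : ℕ) (ω : Ω) (x : UnitAddCircle) :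
    S.φ i (t + 1) ω x = S.φ i 1 (S.θ^[t] ω) (S.φ i t ω x) := by
  rw [add_comm, (hS.rds i).cocycle]

/-- The orbit of a node up to time `t` is determined by the maps before time `t`. -/
theorem measurable_node_past (hS : S.IsStandard P m) (i : Fin (L + 1)) (x : UnitAddCircle) (t : ℕ) :
    Measurable[S.mapInfo (Set.Iio t)] fun ω => S.φ i t ω x := by
  induction t with
  | zero => simp only [(hS.rds i).zero]; exact measurable_const
  | succ t ih =>
    have h1 : Measurable[S.mapInfo (Set.Iio (t + 1))] fun ω => S.φ i t ω x :=
      ih.mono (S.mapInfo_mono (Set.Iio_subset_Iio (by omega))) le_rfl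
    simp only [hS.node_succ i t]
    exact (hS.measurable_node_mapInfo (A := Set.Iio (t + 1)) (Set.mem_Iio.2 (by omega)) i).comp
      (@Measurable.prodMk _ (S.mapInfo (Set.Iio (t + 1))) _ _ _ (S.mapInfo (Set.Iio (t + 1))) _ _
        h1 (@measurable_id _ (S.mapInfo (Set.Iio (t + 1)))))

/-- The index sets of node maps at times before `t` and at time `t` are disjoint, so the σ-algebras
they generate inherit independence from the family. -/
theorem indep_past_present (hS : S.IsStandard P m) (t : ℕ) :
    Indep (S.mapInfo (Set.Iio t)) (S.mapInfo {t}) P := by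
  refine indep_iSup_of_disjoint (fun q => Measurable.comap_le (measurable_pi_lambda _ fun x => ?_))
    hS.node_indep.iIndep ?_
  · exact (hS.measurable_node q.1 1).comp ((hS.measurable_iterate q.2).prodMk measurable_const)
  · rw [Set.disjoint_left]
    intro q hq hq'
    have h1 : q.2 < t := hq
    have h2 : q.2 = t := hq'
    omega

/-- The one step transition probabilities of the nodes multiply. -/
theorem measure_forall_node_mem (hS : S.IsStandard P m) (t : ℕ) (y : Fin L → UnitAddCircle)
    {B : Fin L → Set UnitAddCircle} (hB : ∀ j, MeasurableSet (B j)) :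
    P {ω | ∀ j, S.φ j.succ 1 (S.θ^[t] ω) (y j) ∈ B j} =
      ∏ j, P {ω | S.φ j.succ 1 ω (y j) ∈ B j} := by
  have hinj : Function.Injective fun j : Fin L => ((j.succ, t) : Fin (L + 1) × ℕ) :=
    fun a b h => Fin.succ_injective _ (Prod.ext_iff.1 h).1
  have h1 := (hS.node_indep.precomp hinj).comp
    (fun j (g : UnitAddCircle → UnitAddCircle) => g (y j)) (fun j => measurable_pi_apply (y j))
  have h2 := h1.measure_inter_preimage_eq_mul Finset.univ (sets := B) (fun j _ => hB j)
  have e : {ω | ∀ j, S.φ j.succ 1 (S.θ^[t] ω) (y j) ∈ B j} = ⋂ i ∈ (Finset.univ : Finset (Fin L)),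
      ((fun g : UnitAddCircle → UnitAddCircle => g (y i)) ∘ fun ω => S.φ i.succ 1 (S.θ^[t] ω)) ⁻¹'
        B i := by
    ext ω; simp
  rw [e]
  refine h2.trans (Finset.prod_congr rfl fun j _ => ?_)
  have hm : MeasurableSet {ω | S.φ j.succ 1 ω (y j) ∈ B j} :=
    ((hS.measurable_node j.succ 1).comp (measurable_id.prodMk measurable_const)) (hB j)
  -- Invariance of `P` under `θ` removes the time shift.
  rw [← (hS.shift.iterate t).measure_preimage hm.nullMeasurableSet]
  rfl

theorem nodes_zero (hS : S.IsStandard P m) (q : Ω × (Fin (L + 1) → UnitAddCircle)) :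
    S.nodes 0 q = fun j => q.2 j.succ := by
  ext j; exact (hS.rds j.succ).zero _ _

/-- At each time the isolated nodes are independent with law `m`. -/
theorem map_nodes [IsProbabilityMeasure P] [IsProbabilityMeasure m] (hS : S.IsStandard P m) (t : ℕ) :
    (StarSystem.initialLaw L P m).map (S.nodes t) = Measure.pi fun _ : Fin L => m := by
  symm
  induction t with
  | zero =>
    refine Measure.pi_eq fun B hB => ?_
    rw [Measure.map_apply (hS.measurable_nodes 0) (MeasurableSet.univ_pi hB), initialLaw]
    have e : S.nodes 0 ⁻¹' Set.univ.pi B = (Set.univ : Set Ω) ×ˢ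
        Set.univ.pi (Fin.cons Set.univ B : Fin (L + 1) → Set UnitAddCircle) := by
      ext q
      simp only [Set.mem_preimage, hS.nodes_zero, Set.mem_pi, Set.mem_univ, true_implies,
        Set.mem_prod, true_and]
      constructor
      · intro h i
        refine Fin.cases ?_ (fun j => ?_) i
        · simp
        · simpa using h j
      · intro h j
        simpa using h j.succ
    rw [e, Measure.prod_prod, Measure.pi_pi, Fin.prod_univ_succ]
    simp
  | succ t ih =>
    refine Measure.pi_eq fun B hB => ?_
    rw [Measure.map_apply (hS.measurable_nodes _) (MeasurableSet.univ_pi hB), initialLaw,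
      Measure.prod_apply_symm (hS.measurable_nodes _ (MeasurableSet.univ_pi hB))]
    let r : Fin L → UnitAddCircle → ℝ≥0∞ := fun j x => P {ω | S.φ j.succ 1 ω x ∈ B j}
    have hr : ∀ j, Measurable (r j) := fun j => by
      have h : MeasurableSet {p : UnitAddCircle × Ω | S.φ j.succ 1 p.2 p.1 ∈ B j} :=
        ((hS.measurable_node j.succ 1).comp measurable_swap) (hB j)
      exact measurable_measure_prodMk_left h
    let R : (Fin L → UnitAddCircle) → ℝ≥0∞ := fun y => ∏ j, r j (y j)
    have hR : Measurable R :=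
      Finset.measurable_prod _ fun j _ => (hr j).comp (measurable_pi_apply j)
    -- The Markov property: for a fixed initial state, the state at time `t` depends on past maps
    -- only, so it can be frozen while the maps at time `t` are averaged into the product `R` of
    -- transition probabilities.
    have hstep : ∀ x : Fin (L + 1) → UnitAddCircle,
        P ((fun ω => (ω, x)) ⁻¹' (S.nodes (t + 1) ⁻¹' Set.univ.pi B)) =
          ∫⁻ ω, R (S.nodes t (ω, x)) ∂P := by
      intro x
      have hXp : Measurable[S.mapInfo (Set.Iio t)] fun ω => S.nodes t (ω, x) :=
        @measurable_pi_lambda _ _ _ (S.mapInfo (Set.Iio t)) _ _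
          fun j => hS.measurable_node_past j.succ (x j.succ) t
      have hX : Measurable fun ω => S.nodes t (ω, x) := hXp.mono (hS.mapInfo_le _) le_rfl
      have hQ : @MeasurableSet _ (@Prod.instMeasurableSpace (Fin L → UnitAddCircle) Ω _
          (S.mapInfo {t})) {p | ∀ j, S.φ j.succ 1 (S.θ^[t] p.2) (p.1 j) ∈ B j} := by
        have e : {p : (Fin L → UnitAddCircle) × Ω |
            ∀ j, S.φ j.succ 1 (S.θ^[t] p.2) (p.1 j) ∈ B j} =
            ⋂ j, (fun p : (Fin L → UnitAddCircle) × Ω => S.φ j.succ 1 (S.θ^[t] p.2) (p.1 j)) ⁻¹'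
              B j := by ext p; simp
        rw [e]
        refine @MeasurableSet.iInter _ _ (@Prod.instMeasurableSpace (Fin L → UnitAddCircle) Ω _
          (S.mapInfo {t})) _ _ fun j => ?_
        have h1 := hS.measurable_node_mapInfo (A := {t}) (Set.mem_singleton t) j.succ
        have h2 : @Measurable _ _ (@Prod.instMeasurableSpace (Fin L → UnitAddCircle) Ω _
            (S.mapInfo {t})) (@Prod.instMeasurableSpace UnitAddCircle Ω _ (S.mapInfo {t}))
            fun p : (Fin L → UnitAddCircle) × Ω => (p.1 j, p.2) :=
          @Measurable.prodMk _ (@Prod.instMeasurableSpace (Fin L → UnitAddCircle) Ω _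
            (S.mapInfo {t})) _ _ _ (S.mapInfo {t}) _ _
            ((measurable_pi_apply j).comp (@measurable_fst _ _ _ (S.mapInfo {t})))
            (@measurable_snd _ _ _ (S.mapInfo {t}))
        exact (h1.comp h2) (hB j)
      -- The fresh noise is represented by the identity into `Ω` with the coarser σ-algebra
      -- generated by the maps at time `t`, so no space of maps is needed.
      have hind : @IndepFun Ω (Fin L → UnitAddCircle) Ω _ _ (S.mapInfo {t})
          (fun ω => S.nodes t (ω, x)) id P := by
        refine (IndepFun_iff_Indep (mγ := S.mapInfo {t}) _ _ P).2 ?_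
        rw [MeasurableSpace.comap_id]
        exact indep_of_indep_of_le_left (hS.indep_past_present t) hXp.comap_le
      have h := @measure_joint_eq_lintegral_of_indepFun Ω Ω (Fin L → UnitAddCircle) _
        (S.mapInfo {t}) _ P _ (fun ω => S.nodes t (ω, x)) id hX
        (measurable_id'' (hS.mapInfo_le {t})) hind _ hQ
      have e : (fun ω => (ω, x)) ⁻¹' (S.nodes (t + 1) ⁻¹' Set.univ.pi B) =
          {ω | (S.nodes t (ω, x), id ω) ∈ {p : (Fin L → UnitAddCircle) × Ω |
            ∀ j, S.φ j.succ 1 (S.θ^[t] p.2) (p.1 j) ∈ B j}} := by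
        ext ω
        simp [nodes, hS.node_succ _ t]
      rw [e, h]
      exact lintegral_congr fun ω => hS.measure_forall_node_mem t _ hB
    rw [lintegral_congr hstep]
    have h1 : ∫⁻ x, ∫⁻ ω, R (S.nodes t (ω, x)) ∂P ∂(Measure.pi fun _ : Fin (L + 1) => m) =
        ∫⁻ y, R y ∂(Measure.pi fun _ : Fin L => m) := by
      rw [ih, lintegral_map hR (hS.measurable_nodes t), initialLaw,
        lintegral_prod_symm (fun q => R (S.nodes t q)) (hR.comp (hS.measurable_nodes t)).aemeasurable]
    rw [h1]
    have h2 : iIndepFun (fun (j : Fin L) (y : Fin L → UnitAddCircle) => r j (y j))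
        (Measure.pi fun _ : Fin L => m) :=
      iIndepFun_pi (X := fun j => r j) fun j => (hr j).aemeasurable
    have h3 := lintegral_prod_eq_prod_lintegral_of_indepFun Finset.univ _ h2
      (fun j => (hr j).comp (measurable_pi_apply j))
    have e : ∫⁻ y, R y ∂(Measure.pi fun _ : Fin L => m) = _ := h3
    rw [e]
    refine Finset.prod_congr rfl fun j _ => ?_
    -- Each factor is the `m`-integral of the transition probability to `B j`, which stationarity
    -- identifies with `m (B j)`.
    rw [← hS.stationary j.succ (B j) (hB j)]
    have := lintegral_map (μ := Measure.pi fun _ : Fin L => m) (hr j) (measurable_pi_apply j)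
    rw [(measurePreserving_eval (fun _ : Fin L => m) j).map_eq] at this
    exact this.symm

end StarSystem.IsStandard

end NodeLaw

/-! ### Derivative bounds for periodic functions and the coupling. -/

section CFour

/-- The derivative of a periodic function is controlled by its Lipschitz constant. -/
theorem abs_deriv_le_of_periodic {f g : ℝ → ℝ} {c : ℝ} (hf : ∀ x, HasDerivAt f (g x) x)
    (hper : ∀ x, f (x + 1) = f x) (hg : ∀ x y, |g x - g y| ≤ c * |x - y|) (x : ℝ) :
    |g x| ≤ c / 4 := by
  -- The symmetric difference has derivative at most `2cr`, hence size at most `cr²`. At `r = 1/2`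
  -- periodicity cancels the values of `f` and leaves `|g x| ≤ c / 4`.
  have hF : ∀ r, HasDerivAt (fun r => f (x + r) - f (x - r) - 2 * r * g x)
      (g (x + r) + g (x - r) - 2 * g x) r := fun r => by
    refine ((((hf (x + r)).comp_const_add x r).sub ((hf (x - r)).comp_const_sub x r)).sub
      (((hasDerivAt_id r).const_mul 2).mul_const (g x))).congr_deriv ?_
    ring
  have h := image_norm_le_of_norm_deriv_right_le_deriv_boundary
    (f := fun r => f (x + r) - f (x - r) - 2 * r * g x)
    (f' := fun r => g (x + r) + g (x - r) - 2 * g x) (a := 0) (b := 1 / 2)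
    (B := fun r => c * r ^ 2) (B' := fun r => c * (2 * r))
    (fun r _ => (hF r).continuousAt.continuousWithinAt)
    (fun r _ => (hF r).hasDerivWithinAt) (by simp)
    (fun r => by simpa using ((hasDerivAt_pow 2 r).const_mul c))
    (fun r hr => by
      have h1 := hg (x + r) x
      have h2 := hg (x - r) x
      have e1 : |x + r - x| = r := by rw [add_sub_cancel_left, abs_of_nonneg hr.1]
      have e2 : |x - r - x| = r := by rw [sub_sub_cancel_left, abs_neg, abs_of_nonneg hr.1]
      rw [e1] at h1
      rw [e2] at h2
      rw [Real.norm_eq_abs, show g (x + r) + g (x - r) - 2 * g x =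
        (g (x + r) - g x) + (g (x - r) - g x) by ring]
      refine (abs_add_le _ _).trans ?_
      linarith)
    (x := 1 / 2) (by norm_num)
  have e : f (x + 1 / 2) = f (x - 1 / 2) := by
    rw [← hper (x - 1 / 2)]; congr 1; ring
  simp only [e, sub_self, zero_sub, norm_neg, Real.norm_eq_abs] at h
  rw [show 2 * (1 / 2 : ℝ) * g x = g x by ring] at h
  linarith

theorem abs_sub_le_of_abs_deriv_le {f : ℝ → ℝ} (hf : Differentiable ℝ f) {c : ℝ}
    (h : ∀ x, |deriv f x| ≤ c) (x y : ℝ) : |f x - f y| ≤ c * |x - y| :=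
  Convex.norm_image_sub_le_of_norm_deriv_le (s := Set.univ) (fun z _ => hf z) (fun z _ => h z)
    convex_univ (Set.mem_univ y) (Set.mem_univ x)

theorem iteratedDeriv_periodic {g : ℝ → ℝ} (hper : ∀ x, g (x + 1) = g x) (n : ℕ) (x : ℝ) :
    iteratedDeriv n g (x + 1) = iteratedDeriv n g x := by
  have h : (fun z => g (z + 1)) = g := funext hper
  have := iteratedDeriv_comp_add_const n g 1
  rw [h] at this
  exact (congrFun this x).symm

/-- A `1`-periodic function with fourth derivative bounded by `K` has first derivative bounded by
`K / 64`. -/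
theorem abs_deriv_le_of_iteratedDeriv_four {g : ℝ → ℝ} (hg : ContDiff ℝ 4 g)
    (hper : ∀ x, g (x + 1) = g x) {K : ℝ} (hK : ∀ x, |iteratedDeriv 4 g x| ≤ K) (x : ℝ) :
    |deriv g x| ≤ K / 64 := by
  have hd : ∀ n : ℕ, n < 4 → Differentiable ℝ (iteratedDeriv n g) := fun n hn =>
    hg.differentiable_iteratedDeriv n (by exact_mod_cast hn)
  -- Each application descends one order at the gain of a factor 4; from order four to order one
  -- this is 4³ = 64.
  have step : ∀ (n : ℕ) (c : ℝ), n + 1 < 4 → (∀ x, |iteratedDeriv (n + 2) g x| ≤ c) →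
      ∀ x, |iteratedDeriv (n + 1) g x| ≤ c / 4 := by
    intro n c hn hc x
    refine abs_deriv_le_of_periodic (f := iteratedDeriv n g) (fun z => ?_)
      (iteratedDeriv_periodic hper n) (abs_sub_le_of_abs_deriv_le (hd (n + 1) hn) fun z => ?_) x
    · rw [iteratedDeriv_succ]; exact (hd n (by omega) z).hasDerivAt
    · rw [← iteratedDeriv_succ]; exact hc z
  have h1 := step 0 _ (by norm_num) (step 1 _ (by norm_num) (step 2 K (by norm_num) hK)) x
  rw [zero_add, iteratedDeriv_one] at h1
  linarith

variable {u : UnitAddCircle → UnitAddCircle → ℝ} {K : ℝ}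

theorem abs_iteratedDeriv_le_of_c4Norm (hK : 0 < K) (h : c4Norm u ≤ ENNReal.ofReal K) {b : ℕ}
    (hb : b ≤ 4) (s t : ℝ) : |iteratedDeriv b (fun t' => torusLift u s t') t| ≤ K := by
  have h1 : ‖iteratedDeriv 0 (fun s' => iteratedDeriv b (fun t' => torusLift u s' t') t) s‖ₑ ≤
      c4Norm u :=
    le_iSup_of_le 0 (le_iSup_of_le b (le_iSup_of_le (by omega) (le_iSup_of_le s
      (le_iSup_of_le t le_rfl))))
  rw [iteratedDeriv_zero] at h1
  have h2 := h1.trans h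
  rw [← ofReal_norm, ENNReal.ofReal_le_ofReal_iff hK.le] at h2
  exact h2

theorem abs_le_of_c4Norm (hK : 0 < K) (h : c4Norm u ≤ ENNReal.ofReal K) (x y : UnitAddCircle) :
    |u x y| ≤ K := by
  obtain ⟨s, rfl⟩ := QuotientAddGroup.mk_surjective x
  obtain ⟨t, rfl⟩ := QuotientAddGroup.mk_surjective y
  simpa [torusLift] using abs_iteratedDeriv_le_of_c4Norm hK h (b := 0) (by norm_num) s t

theorem contDiff_section (hu : IsC4 u) (x : UnitAddCircle) : ContDiff ℝ 4 fun t : ℝ => u x t := by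
  obtain ⟨s, rfl⟩ := QuotientAddGroup.mk_surjective x
  exact ContDiff.comp (g := fun p : ℝ × ℝ => torusLift u p.1 p.2) hu
    (contDiff_prodMk_right (𝕜 := ℝ) s)

/-- Makes the coupling Lipschitz in the neighbour's state uniformly over the hub position. The gain
of 64 is what pays for the numerical constant in the exponent. -/
theorem abs_deriv_section_le (hu : IsC4 u) (hK : 0 < K) (h : c4Norm u ≤ ENNReal.ofReal K)
    (x : UnitAddCircle) (t : ℝ) : |deriv (fun t : ℝ => u x t) t| ≤ K / 64 := by
  obtain ⟨s, rfl⟩ := QuotientAddGroup.mk_surjective x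
  refine abs_deriv_le_of_iteratedDeriv_four (contDiff_section hu _) (fun z => ?_)
    (fun z => abs_iteratedDeriv_le_of_c4Norm hK h le_rfl s z) t
  rw [AddCircle.coe_add_period]

end CFour

/-! ### From fluctuations to the discrepancy of the shadowing nodes. -/

section Reduction

variable {Ω : Type*} {L : ℕ}

theorem empDev_const_mul (m : Measure UnitAddCircle) (c : ℝ) (u : UnitAddCircle → ℝ)
    (y : Fin L → UnitAddCircle) : empDev m (fun x => c * u x) y = c * empDev m u y := by
  simp only [empDev, integral_const_mul, ← Finset.mul_sum]
  ring

theorem discrepancy_le_one (m : Measure UnitAddCircle) [IsProbabilityMeasure m] (hL : 1 ≤ L)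
    (y : Fin L → UnitAddCircle) : discrepancy m y ≤ 1 := by
  have : Nonempty {u : UnitAddCircle → ℝ // IsUnitC1 u} := ⟨⟨_, isUnitC1_zero⟩⟩
  exact ciSup_le fun u => abs_empDev_le_one m hL u.2 y

/-- Tail bound for the discrepancy in the form used for the exceptional frequencies. -/
theorem measureReal_discrepancy_gt_le_inv_mul (m : Measure UnitAddCircle) [IsProbabilityMeasure m]
    (hL : 1 ≤ L) {r : ℝ} (hr : 0 < r) :
    (Measure.pi fun _ : Fin L => m).real {y | 16 * r < discrepancy m y} ≤
      1 / r * Real.exp (-(512 * (L * r ^ 2))) := by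
  -- For `r ≥ 1/2` the event is empty because the discrepancy never exceeds 1; for `r ≤ 1/2` the
  -- prefactor 2 is at most `1 / r`.
  rcases le_total (1 / 2) r with h | h
  · have hempty : {y : Fin L → UnitAddCircle | 16 * r < discrepancy m y} = ∅ := by
      ext y
      simp only [Set.mem_ofPred_eq, Set.mem_empty_iff_false, iff_false, not_lt]
      linarith [discrepancy_le_one m hL y]
    rw [hempty, measureReal_empty]
    positivity
  · refine (measureReal_discrepancy_gt_le m hL (by positivity : 0 ≤ 16 * r)).trans ?_
    have e : -(2 * (L : ℝ) * (16 * r) ^ 2) = -(512 * (L * r ^ 2)) := by ring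
    rw [e]
    gcongr
    rw [le_div_iff₀ hr]; linarith

variable {S : StarSystem Ω L} {K : ℝ}

theorem fluctAt_eq_mul_empDev (S : StarSystem Ω L) (m : Measure UnitAddCircle) (t : ℕ)
    (p : Ω × (Fin (L + 1) → UnitAddCircle)) :
    S.fluctAt m t p = S.α * empDev m (S.h (S.θ^[t] p.1) (S.orbit t p.1 p.2 0))
      fun j => S.orbit t p.1 p.2 j.succ := rfl

theorem supC0_nonneg (S : StarSystem Ω L) (ω : Ω) : 0 ≤ S.supC0 ω :=
  Real.iSup_nonneg fun _ => abs_nonneg _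

theorem supC0_le {B : ℝ} {ω : Ω} (h : ∀ t x y, |S.h (S.θ^[t] ω) x y| ≤ B) : S.supC0 ω ≤ B :=
  ciSup_le fun q => h q.1 q.2.1 q.2.2

/-- The shadowing precision along an orbit on which the coupling is bounded by `B`. -/
theorem dist_orbit_nodes_le {εs : ℝ → ℝ} (hε : IsShadowingPrecision εs) (hα : 0 < S.α)
    {p q : Ω × (Fin (L + 1) → UnitAddCircle)} (hpq : S.Shadowing εs p q) {B : ℝ}
    (hB : S.supC0 p.1 ≤ B) (t : ℕ) (j : Fin L) :
    dist (S.orbit t p.1 p.2 j.succ) (S.nodes t q j) ≤ εs (S.α / L * B) := by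
  have h0 := supC0_nonneg S p.1
  refine (hpq t j).trans (hε.mono ?_ ?_ ?_)
  · exact Set.mem_Ici.2 (by positivity)
  · have := h0.trans hB
    exact Set.mem_Ici.2 (by positivity)
  · gcongr

/-- The fluctuation is controlled by the discrepancy of the shadowing nodes. -/
theorem abs_fluctAt_le_discrepancy {m : Measure UnitAddCircle} [IsProbabilityMeasure m]
    (hL : 1 ≤ L) (hα : 0 < S.α) (hC4 : ∀ ω, IsC4 (S.h ω)) (hK : 0 < K)
    (hKn : ∀ ω, c4Norm (S.h ω) ≤ ENNReal.ofReal K) {εs : ℝ → ℝ} (hε : IsShadowingPrecision εs)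
    {p q : Ω × (Fin (L + 1) → UnitAddCircle)} (hpq : S.Shadowing εs p q) (t : ℕ) :
    |S.fluctAt m t p| ≤
      S.α * (K / 64) * (discrepancy m (S.nodes t q) + εs (S.α / L * K)) := by
  set ω' := S.θ^[t] p.1
  -- The test function is random and depends on the nodes through the hub, so a concentration bound
  -- for a fixed function would not apply; the discrepancy is uniform over such `v`.
  set v : UnitAddCircle → ℝ := S.h ω' (S.orbit t p.1 p.2 0) with hv
  have hvC : ContDiff ℝ 4 fun s : ℝ => v s := contDiff_section (hC4 ω') _
  have hvd : ∀ s : ℝ, |deriv (fun s : ℝ => v s) s| ≤ K / 64 :=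
    abs_deriv_section_le (hC4 ω') hK (hKn ω') _
  have hsup : S.supC0 p.1 ≤ K := supC0_le fun t x y => abs_le_of_c4Norm hK (hKn _) x y
  have hlip : LipschitzWith (K / 64).toNNReal v :=
    lipschitzWith_of_abs_deriv_le (hvC.differentiable (by norm_num)) fun s => by
      rw [Real.coe_toNNReal _ (by positivity)]; exact hvd s
  have h1 := abs_empDev_sub_le m hL hlip (fun j => S.orbit t p.1 p.2 j.succ) (S.nodes t q)
    (dist_orbit_nodes_le hε hα hpq hsup t)
  rw [Real.coe_toNNReal _ (by positivity)] at h1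
  have hunit : IsUnitC1 fun x => 64 / K * v x := by
    refine ⟨contDiff_const.mul (hvC.of_le (by norm_num)), fun s => ?_⟩
    rw [deriv_const_mul _ (hvC.differentiable (by norm_num) s), abs_mul,
      abs_of_pos (by positivity : 0 < 64 / K)]
    calc 64 / K * |deriv (fun s : ℝ => v s) s| ≤ 64 / K * (K / 64) := by gcongr; exact hvd s
      _ = 1 := by field_simp
  have h2 := abs_empDev_le_discrepancy m hL hunit (S.nodes t q)
  rw [empDev_const_mul, abs_mul, abs_of_pos (by positivity : 0 < 64 / K), div_mul_eq_mul_div,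
    div_le_iff₀ hK] at h2
  have h3 := abs_sub_abs_le_abs_sub (empDev m v fun j => S.orbit t p.1 p.2 j.succ)
    (empDev m v (S.nodes t q))
  rw [fluctAt_eq_mul_empDev, abs_mul, abs_of_pos hα, mul_assoc]
  gcongr
  linarith

/-- A large fluctuation forces a large discrepancy of the shadowing nodes. -/
theorem lt_discrepancy_of_lt_abs_fluctAt {m : Measure UnitAddCircle} [IsProbabilityMeasure m]
    (hL : 1 ≤ L) (hα : 0 < S.α) (hC4 : ∀ ω, IsC4 (S.h ω)) (hK : 0 < K)
    (hKn : ∀ ω, c4Norm (S.h ω) ≤ ENNReal.ofReal K) {εs : ℝ → ℝ} (hεs : IsShadowingPrecision εs)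
    {ε : ℝ} (hε : 0 < ε) (hle : 4 * S.α * K * εs (S.α / L * K) ≤ ε)
    {p q : Ω × (Fin (L + 1) → UnitAddCircle)} (hpq : S.Shadowing εs p q) {t : ℕ}
    (ht : ε < |S.fluctAt m t p|) : 32 * (ε / (S.α * K)) < discrepancy m (S.nodes t q) := by
  have h := ht.trans_le (abs_fluctAt_le_discrepancy (m := m) hL hα hC4 hK hKn hεs hpq t)
  have hαK : 0 < S.α * K := by positivity
  rw [← mul_div_assoc, div_lt_iff₀ hαK]
  -- The shadowing term contributes at most `ε / 256`, so the discrepancy in fact exceeds `63 ε /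
  -- (αK)`; the constant 32 leaves ample room.
  nlinarith

end Reduction

/-! ### The three parts of the theorem. -/

section MainParts

variable {Ω : Type*} {m : Measure UnitAddCircle} {L : ℕ} {S : StarSystem Ω L} {K : ℝ}
  {εs : ℝ → ℝ}

/-- Empirical frequencies of large fluctuations are dominated by a continuous test function of the
shadowing nodes. -/
theorem admitsReduction_of_typicality [IsProbabilityMeasure m] (hL : 1 ≤ L) {p q : Ω × (Fin (L + 1) → UnitAddCircle)}
    (htyp : S.Typicality m q) {ε r ρ : ℝ} (hr : 0 < r)
    (hlarge : ∀ t, ε < |S.fluctAt m t p| → 32 * r < discrepancy m (S.nodes t q))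
    (hρ : (Measure.pi fun _ : Fin L => m).real {y | 16 * r < discrepancy m y} ≤ ρ) :
    S.AdmitsReduction m ε ρ p := by
  classical
  have hdc : Continuous (discrepancy m : (Fin L → UnitAddCircle) → ℝ) :=
    (lipschitzWith_discrepancy m hL).continuous
  -- Weak convergence sees continuous functions only: `g` rises linearly from 0 at discrepancy `16
  -- r` to 1 at `32 r`, so it dominates the bad event and is dominated by a slightly larger one.
  let g : C(Fin L → UnitAddCircle, ℝ) :=
    ⟨fun y => min 1 (max 0 (discrepancy m y / (16 * r) - 1)), by fun_prop⟩
  have hg : ∀ y, g y = min 1 (max 0 (discrepancy m y / (16 * r) - 1)) := fun _ => rfl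
  have hg0 : ∀ y, 0 ≤ g y := fun y => by rw [hg]; exact le_min zero_le_one (le_max_left _ _)
  have hg1 : ∀ y, 32 * r < discrepancy m y → g y = 1 := fun y hy => by
    rw [hg]
    refine min_eq_left (le_max_of_le_right ?_)
    rw [le_sub_iff_add_le, le_div_iff₀ (by positivity)]
    linarith
  have hgint : ∫ y, g y ∂(Measure.pi fun _ : Fin L => m) ≤ ρ := by
    refine le_trans ?_ hρ
    have hm : MeasurableSet {y : Fin L → UnitAddCircle | 16 * r < discrepancy m y} :=
      measurableSet_lt measurable_const hdc.measurable
    rw [← integral_indicator_one hm]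
    refine integral_mono_of_nonneg (ae_of_all _ hg0)
      ((integrable_const (1 : ℝ)).indicator hm) (ae_of_all _ fun y => ?_)
    by_cases hy : 16 * r < discrepancy m y
    · rw [Set.indicator_of_mem (by exact hy), hg]
      exact min_le_left _ _
    · rw [Set.indicator_of_notMem (by exact hy), hg]
      refine (min_le_right _ _).trans (max_le le_rfl ?_)
      rw [sub_nonpos, div_le_one (by positivity)]
      exact not_lt.1 hy
  have hfreq : ∀ T : ℕ, (1 / T : ℝ) * (Nat.card {t : ℕ // t < T ∧ ε < |S.fluctAt m t p|} : ℝ) ≤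
      (1 / T : ℝ) * ∑ t ∈ Finset.range T, g (S.nodes t q) := fun T => by
    gcongr
    rw [Nat.subtype_card ((Finset.range T).filter fun t => ε < |S.fluctAt m t p|) (by simp),
      Finset.card_filter]
    push_cast
    refine Finset.sum_le_sum fun t _ => ?_
    split_ifs with h
    · rw [hg1 _ (hlarge t h)]
    · exact hg0 _
  have hlim := htyp g
  refine le_trans ?_ hgint
  rw [← hlim.limsup_eq]
  refine limsup_le_limsup (Eventually.of_forall hfreq) ?_ hlim.isBoundedUnder_le
  -- The real `limsup` is monotone only under boundedness conditions; nonnegative frequencies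
  -- provide the lower one.
  exact (isBoundedUnder_of ⟨0, fun T => by positivity⟩).isCoboundedUnder_le

variable [MeasurableSpace Ω] {P : Measure Ω}

/-- Almost sure reduction in asymptotic time. -/
theorem ae_admitsReduction [IsProbabilityMeasure m] (hL : 1 ≤ L) (hS : S.IsStandard P m) (hεs : IsShadowingPrecision εs)
    (hA : S.AdmitsACS P m εs) (hK : 0 < K) (hKn : ∀ ω, c4Norm (S.h ω) ≤ ENNReal.ofReal K)
    {C : ℝ} (hC : 1 ≤ C) {ε : ℝ} (hε : 0 < ε) (hle : 4 * S.α * K * εs (S.α / L * K) ≤ ε) :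
    ∀ᵐ p ∂(StarSystem.initialLaw L P m), S.AdmitsReduction m ε
      (C * (S.α * K / ε) * Real.exp (-(450 / K ^ 2) * (L * ε ^ 2 / S.α ^ 2))) p := by
  obtain ⟨A, -, hAp⟩ := hA
  have hα := hS.coupling_pos
  filter_upwards [hAp] with p hp
  have hr : 0 < ε / (S.α * K) := by positivity
  refine admitsReduction_of_typicality hL hp.2 hr
    (fun t ht => lt_discrepancy_of_lt_abs_fluctAt hL hα hS.coupling_C4 hK hKn hεs hε hle hp.1 ht) ?_
  refine (measureReal_discrepancy_gt_le_inv_mul m hL hr).trans ?_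
  have e1 : 1 / (ε / (S.α * K)) = S.α * K / ε := by rw [one_div_div]
  -- The tail bound carries 512 in place of 450, so the claimed exponent is the weaker one.
  have e2 : -(450 / K ^ 2) * (L * ε ^ 2 / S.α ^ 2) = -(450 * (L * (ε / (S.α * K)) ^ 2)) := by
    field_simp
  rw [e1, e2]
  have h1 : S.α * K / ε ≤ C * (S.α * K / ε) := le_mul_of_one_le_left (by positivity) hC
  have h2 : 0 ≤ (L : ℝ) * (ε / (S.α * K)) ^ 2 := by positivity
  gcongr
  norm_num

/-- Small fluctuations in exponentially long time windows. -/
theorem exists_exceptional_set [IsProbabilityMeasure P] [IsProbabilityMeasure m] (hL : 1 ≤ L)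
    (hS : S.IsStandard P m) (hεs : IsShadowingPrecision εs) (hA : S.AdmitsACS P m εs) (hKn : ∀ ω, c4Norm (S.h ω) ≤ ENNReal.ofReal K) {C : ℝ} (hC : 4 ≤ C)
    {κ : ℝ} (hκ : 0 < κ) (hκ2 : κ < 1 / 2) (hK : 1 ≤ K)
    (hle : 4 * S.α * K * εs (S.α / L * K) ≤ (L : ℝ) ^ (-κ) * S.α * K ^ 2) (t₀ : ℕ) :
    ∃ E : Set (Ω × (Fin (L + 1) → UnitAddCircle)), MeasurableSet E ∧
      StarSystem.initialLaw L P m E ≤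
        ENNReal.ofReal (C * (L : ℝ) ^ κ * Real.exp (-(L : ℝ) ^ (1 - 2 * κ))) ∧
      ∀ p ∉ E, ∀ t : ℕ, t₀ ≤ t → t < t₀ + ⌈Real.exp ((L : ℝ) ^ (1 - 2 * κ))⌉₊ →
        |S.fluctAt m t p| ≤ (L : ℝ) ^ (-κ) * S.α * K ^ 2 := by
  have hL1 : (1 : ℝ) ≤ L := by exact_mod_cast hL
  have hL0 : (0 : ℝ) < L := by linarith
  have hα := hS.coupling_pos
  have hK0 : 0 < K := by linarith
  set ε := (L : ℝ) ^ (-κ) * S.α * K ^ 2 with hεd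
  have hε : 0 < ε := by positivity
  set a := (L : ℝ) ^ (1 - 2 * κ) with ha
  have ha1 : 1 ≤ a := Real.one_le_rpow hL1 (by linarith)
  set T := ⌈Real.exp a⌉₊ with hT
  set law := StarSystem.initialLaw L P m with hlaw
  obtain ⟨A, hAm, hAp⟩ := hA
  set r := ε / (S.α * K) with hr
  have hr0 : 0 < r := by positivity
  have hre : r = (L : ℝ) ^ (-κ) * K := by rw [hr, hεd]; field_simp
  -- Here `r = L^(-κ) K`, so `L r² = L^(1-2κ) K²`, and `K ≥ 1`.
  have hLr : a ≤ L * r ^ 2 := by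
    have h1 : L * r ^ 2 = a * K ^ 2 := by
      rw [hre, mul_pow, ← Real.rpow_natCast ((L : ℝ) ^ (-κ)), ← Real.rpow_mul hL0.le, ha,
        ← mul_assoc]
      congr 1
      nth_rewrite 1 [← Real.rpow_one (L : ℝ)]
      rw [← Real.rpow_add hL0]
      congr 1
      push_cast
      ring
    rw [h1]
    exact le_mul_of_one_le_right (by linarith) (one_le_pow₀ hK)
  have hdm : MeasurableSet {y : Fin L → UnitAddCircle | 16 * r < discrepancy m y} :=
    measurableSet_lt measurable_const (lipschitzWith_discrepancy m hL).continuous.measurable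
  -- Invariance of the law under `A` transfers the event to the isolated nodes, which have law
  -- `m^{⊗L}` at time `t`. The exponent 2 (out of 512) leaves one `exp (-a)` after the union bound
  -- over about `exp a` times.
  have hbad : ∀ t, law {p | ε < |S.fluctAt m t p|} ≤ ENNReal.ofReal (2 * Real.exp (-(2 * a))) := by
    intro t
    have h1 : law {p | ε < |S.fluctAt m t p|} ≤
        law (A ⁻¹' (S.nodes t ⁻¹' {y | 16 * r < discrepancy m y})) := by
      refine measure_mono_ae ?_
      filter_upwards [hAp] with p hp hpt
      have := lt_discrepancy_of_lt_abs_fluctAt hL hα hS.coupling_C4 hK0 hKn hεs hε hle hp.1 hpt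
      change 16 * r < discrepancy m (S.nodes t (A p))
      linarith
    refine h1.trans ?_
    rw [hAm.measure_preimage (hS.measurable_nodes t hdm).nullMeasurableSet,
      ← Measure.map_apply (hS.measurable_nodes t) hdm, hS.map_nodes t, ← ofReal_measureReal]
    refine ENNReal.ofReal_le_ofReal ((measureReal_discrepancy_gt_le m hL (by positivity)).trans ?_)
    refine mul_le_mul_of_nonneg_left (Real.exp_le_exp.2 ?_) (by norm_num)
    linarith [show 2 * (L : ℝ) * (16 * r) ^ 2 = 512 * (L * r ^ 2) by ring]
  -- A measurable hull has the same measure as the bad event, so measurability of the network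
  -- fluctuation need not be established.
  refine ⟨toMeasurable law (⋃ t ∈ Finset.Ico t₀ (t₀ + T), {p | ε < |S.fluctAt m t p|}),
    measurableSet_toMeasurable _ _, ?_, fun p hp t ht ht' => ?_⟩
  · rw [measure_toMeasurable]
    refine (measure_biUnion_finset_le _ _).trans ((Finset.sum_le_sum fun t _ => hbad t).trans ?_)
    rw [Finset.sum_const, Nat.card_Ico, add_tsub_cancel_left, nsmul_eq_mul,
      ← ENNReal.ofReal_natCast, ← ENNReal.ofReal_mul (by positivity)]
    refine ENNReal.ofReal_le_ofReal ?_
    have hTle : (T : ℝ) ≤ 2 * Real.exp a := by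
      have h1 := (Nat.ceil_lt_add_one (Real.exp_pos a).le).le
      have h2 : 1 ≤ Real.exp a := Real.one_le_exp (by linarith)
      linarith
    have hLk : 1 ≤ (L : ℝ) ^ κ := Real.one_le_rpow hL1 hκ.le
    calc (T : ℝ) * (2 * Real.exp (-(2 * a))) ≤ 2 * Real.exp a * (2 * Real.exp (-(2 * a))) := by
          gcongr
      _ = 4 * (Real.exp a * Real.exp (-(2 * a))) := by ring
      _ = 4 * 1 * Real.exp (-a) := by rw [← Real.exp_add]; ring_nf
      _ ≤ C * (L : ℝ) ^ κ * Real.exp (-a) := by gcongr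
  · by_contra hlt
    refine hp (subset_toMeasurable _ _ ?_)
    simp only [Set.mem_iUnion]
    exact ⟨t, Finset.mem_Ico.2 ⟨ht, ht'⟩, not_le.1 hlt⟩

/-- Almost surely the orbit of the noise stays in the region where a bounded coupling of gradient
type does not exceed its essential bound. -/
theorem ae_supC0_le (hS : S.IsStandard P m) {f : UnitAddCircle → ℝ} {ψ : Ω → ℝ} (hf : Continuous f)
    (hψ : ∃ B : ℝ, ∀ ω, |ψ ω| ≤ B) (hh : ∀ ω x y, S.h ω x y = f x - f y + ψ ω) :
    ∀ᵐ ω ∂P, S.supC0 ω ≤ 2 * (⨆ x, |f x|) + (eLpNorm ψ ∞ P).toReal := by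
  obtain ⟨B, hB⟩ := hψ
  have hfin : eLpNorm ψ ∞ P ≠ ∞ := by
    rw [eLpNorm_exponent_top]
    exact (eLpNormEssSup_lt_top_of_ae_bound (C := B) (ae_of_all _ hB)).ne
  have h1 : ∀ᵐ ω ∂P, |ψ ω| ≤ (eLpNorm ψ ∞ P).toReal := by
    filter_upwards [enorm_ae_le_eLpNormEssSup ψ P] with ω hω
    rw [← eLpNorm_exponent_top] at hω
    simpa using ENNReal.toReal_mono hfin hω
  -- The essential bound holds along the whole orbit: `θ` preserves null sets and there are
  -- countably many times.
  have h2 : ∀ᵐ ω ∂P, ∀ t, |ψ (S.θ^[t] ω)| ≤ (eLpNorm ψ ∞ P).toReal :=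
    ae_all_iff.2 fun t => (hS.shift.iterate t).quasiMeasurePreserving.ae h1
  have hbdd : BddAbove (Set.range fun x => |f x|) := (isCompact_range hf.abs).bddAbove
  filter_upwards [h2] with ω hω
  refine supC0_le fun t x y => ?_
  rw [hh]
  have hx := le_ciSup hbdd x
  have hy := le_ciSup hbdd y
  have := abs_add_le (f x - f y) (ψ (S.θ^[t] ω))
  have := abs_sub (f x) (f y)
  have := hω t
  linarith

/-- Gaussian fluctuations at a fixed time. -/
theorem fluctAt_normal_approx [IsProbabilityMeasure P] [IsProbabilityMeasure m] (hL : 1 ≤ L)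
    (hS : S.IsStandard P m) (hεs : IsShadowingPrecision εs) (hA : S.AdmitsACS P m εs) {f : UnitAddCircle → ℝ} {ψ : Ω → ℝ} {l : ℝ≥0}
    (hf : LipschitzWith l f) (hψ : ∃ B : ℝ, ∀ ω, |ψ ω| ≤ B)
    (hh : ∀ ω x y, S.h ω x y = f x - f y + ψ ω) (t : ℕ) (s c₁ c₂ : ℝ)
    (hc₁ : c₁ = S.α * l * εs (S.α / L * (2 * (⨆ x, |f x|) + (eLpNorm ψ ∞ P).toReal)))
    (hc₂ : ∀ s, |(Measure.pi fun _ : Fin L => m).real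
        {y | S.α * (∫ x, f x ∂m - 1 / L * ∑ j, f (y j)) ≤ s} -
      cdf (gaussianReal 0 (S.α ^ 2 * obsVar m f / L).toNNReal) s| ≤ c₂) :
    (StarSystem.initialLaw L P m).real {p | S.fluctAt m t p ≤ s} ∈ Set.Icc
      (cdf (gaussianReal 0 (S.α ^ 2 * obsVar m f / L).toNNReal) (s - c₁) - c₂)
      (cdf (gaussianReal 0 (S.α ^ 2 * obsVar m f / L).toNNReal) (s + c₁) + c₂) := by
  have hL0 : (L : ℝ) ≠ 0 := by exact_mod_cast (by omega : L ≠ 0)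
  have hα := hS.coupling_pos
  obtain ⟨A, hAm, hAp⟩ := hA
  have hprob : IsProbabilityMeasure (StarSystem.initialLaw L P m) := by
    unfold StarSystem.initialLaw; infer_instance
  set law := StarSystem.initialLaw L P m with hlaw
  let η : (Fin L → UnitAddCircle) → ℝ := fun y => S.α * (∫ x, f x ∂m - 1 / L * ∑ j, f (y j))
  have hη : ∀ y, η y = -(S.α * empDev m f y) := fun y => by simp only [η, empDev]; ring
  have hηm : Measurable η := by
    have : Continuous η := by have := hf.continuous; fun_prop
    exact this.measurable
  -- The hub value and the noise occur identically in the empirical mean and in the `m`-mean and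
  -- cancel, so no supremum over test functions is needed here.
  have hfl : ∀ p, S.fluctAt m t p = η fun j => S.orbit t p.1 p.2 j.succ := fun p => by
    have hi : Integrable f m := integrable_of_continuous_circle hf.continuous
    simp only [StarSystem.fluctAt, StarSystem.fluct, hh, η]
    set z := f (S.orbit t p.1 p.2 0)
    set w := ψ (S.θ^[t] p.1)
    have e1 : ∫ y, (z - f y + w) ∂m = z - ∫ y, f y ∂m + w := by
      have hzi : Integrable (fun y => z - f y) m := (integrable_const z).sub hi
      rw [integral_add hzi (integrable_const _),
        integral_sub (integrable_const _) hi]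
      simp
    have e2 : ∑ j : Fin L, (z - f (S.orbit t p.1 p.2 j.succ) + w) =
        L * z - ∑ j : Fin L, f (S.orbit t p.1 p.2 j.succ) + L * w := by
      simp [Finset.sum_add_distrib, Finset.sum_sub_distrib]
    rw [e1, e2]
    field_simp
    ring
  have hsupae : ∀ᵐ p ∂law, S.supC0 p.1 ≤ 2 * (⨆ x, |f x|) + (eLpNorm ψ ∞ P).toReal :=
    Measure.quasiMeasurePreserving_fst.ae (ae_supC0_le hS hf.continuous hψ hh)
  -- Almost surely the network fluctuation lies within `c₁` of a function of the isolated nodes;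
  -- both inclusions of events below follow from this.
  have hclose : ∀ᵐ p ∂law, |S.fluctAt m t p - η (S.nodes t (A p))| ≤ c₁ := by
    filter_upwards [hAp, hsupae] with p hp hsup
    have h1 := abs_empDev_sub_le m hL hf (fun j => S.orbit t p.1 p.2 j.succ) (S.nodes t (A p))
      (dist_orbit_nodes_le hεs hα hp.1 hsup t)
    rw [hfl, hη, hη, neg_sub_neg, ← mul_sub, abs_mul, abs_of_pos hα, abs_sub_comm, hc₁, mul_assoc]
    gcongr
  have hmeas : ∀ s, law.real {p | η (S.nodes t (A p)) ≤ s} =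
      (Measure.pi fun _ : Fin L => m).real {y | η y ≤ s} := fun s => by
    have hm : MeasurableSet {y | η y ≤ s} := measurableSet_le hηm measurable_const
    rw [← hS.map_nodes t, map_measureReal_apply (hS.measurable_nodes t) hm,
      ← hAm.measureReal_preimage (hS.measurable_nodes t hm).nullMeasurableSet]
    rfl
  constructor
  · have h1 : law.real {p | η (S.nodes t (A p)) ≤ s - c₁} ≤ law.real {p | S.fluctAt m t p ≤ s} := by
      refine ENNReal.toReal_mono (measure_ne_top _ _) (measure_mono_ae ?_)
      filter_upwards [hclose] with p hp hps
      have h2 : η (S.nodes t (A p)) ≤ s - c₁ := hps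
      change S.fluctAt m t p ≤ s
      linarith [(abs_le.1 hp).2]
    have h2 := (abs_le.1 (hc₂ (s - c₁))).1
    rw [hmeas] at h1
    linarith
  · have h1 : law.real {p | S.fluctAt m t p ≤ s} ≤ law.real {p | η (S.nodes t (A p)) ≤ s + c₁} := by
      refine ENNReal.toReal_mono (measure_ne_top _ _) (measure_mono_ae ?_)
      filter_upwards [hclose] with p hp hps
      have h2 : S.fluctAt m t p ≤ s := hps
      change η (S.nodes t (A p)) ≤ s + c₁
      linarith [(abs_le.1 hp).1]
    have h2 := (abs_le.1 (hc₂ (s + c₁))).2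
    rw [hmeas] at h1
    linarith

end MainParts

/-! ### Assembly. -/

theorem mainTheorem7 :
    ∃ C : ℝ, 0 < C ∧
      ∀ (Ω : Type*) [MeasurableSpace Ω] (P : Measure Ω) [IsProbabilityMeasure P]
        (m : Measure UnitAddCircle) [IsProbabilityMeasure m]
        (L : ℕ) (_ : 1 ≤ L) (S : StarSystem Ω L) (_ : S.IsStandard P m)
        (εs : ℝ → ℝ) (_ : IsShadowingPrecision εs) (_ : S.AdmitsACS P m εs)
        (K : ℝ) (_ : 0 < K) (_ : ∀ ω, c4Norm (S.h ω) ≤ ENNReal.ofReal K),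
        -- (i) almost sure reduction in asymptotic time
        (∀ ε : ℝ, max (S.α * (L : ℝ) ^ (-(1 / 2) : ℝ)) (4 * S.α * K * εs (S.α / L * K)) ≤ ε →
          ∀ᵐ p ∂(StarSystem.initialLaw L P m),
            S.AdmitsReduction m ε
              (C * (S.α * K / ε) * Real.exp (-(450 / K ^ 2) * (L * ε ^ 2 / S.α ^ 2))) p) ∧
        -- (ii) small fluctuations in exponentially long time windows
        (∀ κ : ℝ, 0 < κ → κ < 1 / 2 → 1 ≤ K →
          4 * S.α * K * εs (S.α / L * K) ≤ (L : ℝ) ^ (-κ) * S.α * K ^ 2 →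
          ∀ t₀ : ℕ, ∃ E : Set (Ω × (Fin (L + 1) → UnitAddCircle)), MeasurableSet E ∧
            StarSystem.initialLaw L P m E ≤
              ENNReal.ofReal (C * (L : ℝ) ^ κ * Real.exp (-(L : ℝ) ^ (1 - 2 * κ))) ∧
            ∀ p ∉ E, ∀ t : ℕ, t₀ ≤ t → t < t₀ + ⌈Real.exp ((L : ℝ) ^ (1 - 2 * κ))⌉₊ →
              |S.fluctAt m t p| ≤ (L : ℝ) ^ (-κ) * S.α * K ^ 2) ∧
        -- (iii) Gaussian fluctuations at a fixed time
        (∀ (f : UnitAddCircle → ℝ) (ψ : Ω → ℝ) (ℓ : ℝ≥0), LipschitzWith ℓ f →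
          (∃ B : ℝ, ∀ ω, |ψ ω| ≤ B) →
          (∀ ω x y, S.h ω x y = f x - f y + ψ ω) →
          ∀ (t : ℕ) (s c₁ c₂ : ℝ),
            c₁ = S.α * ℓ * εs (S.α / L * (2 * (⨆ x, |f x|) + (eLpNorm ψ ∞ P).toReal)) →
            c₂ = C * (obsThird m f / √(obsVar m f) ^ 3) / √(L : ℝ) →
            (StarSystem.initialLaw L P m).real {p | S.fluctAt m t p ≤ s} ∈ Set.Icc
              (cdf (gaussianReal 0 (S.α ^ 2 * obsVar m f / L).toNNReal) (s - c₁) - c₂)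
              (cdf (gaussianReal 0 (S.α ^ 2 * obsVar m f / L).toNNReal) (s + c₁) + c₂)) := by
  obtain ⟨C, hC, hBE⟩ := exists_berryEsseen_const
  -- One constant for all parts: (i) needs at least 1, (ii) at least 4, and (iii) at least the
  -- Berry–Esseen constant.
  refine ⟨C + 4, by linarith, ?_⟩
  intro Ω _ P _ m _ L hL S hS εs hεs hA K hK hKn
  have hL0 : (0 : ℝ) < L := by exact_mod_cast hL
  have hα := hS.coupling_pos
  refine ⟨fun ε hε => ?_, fun κ hκ hκ2 hK1 hle t₀ => ?_, fun f ψ ℓ hf hψ hh t s c₁ c₂ hc₁ hc₂ => ?_⟩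
  · exact ae_admitsReduction hL hS hεs hA hK hKn (by linarith)
      ((by positivity : 0 < S.α * (L : ℝ) ^ (-(1 / 2) : ℝ)).trans_le ((le_max_left _ _).trans hε))
      ((le_max_right _ _).trans hε)
  · exact exists_exceptional_set hL hS hεs hA hKn (by linarith) hκ hκ2 hK1 hle t₀
  · refine fluctAt_normal_approx hL hS hεs hA hf hψ hh t s c₁ c₂ hc₁ fun s => ?_
    refine (hBE m f hf.continuous L hL S.α hα s).trans ?_
    have hthird : 0 ≤ obsThird m f := integral_nonneg fun x => by positivity
    rw [hc₂]
    gcongr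
    linarith
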